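/- Let $K$ be a global function field of characteristic $\neq 2$ with full field of constants $\Bbbk$; that is, $\Bbbk$ is a finite field, $K$ is a finite extension of $\Bbbk(t)$ for some $t\in K$ transcendental over $\Bbbk$, and $\Bbbk$ is algebraically closed in $K$. Let $X$ be the set of points of $K$, i.e. of the discrete valuation rings $\mathcal{O}_{\mathfrak q}$ with field of fractions $K$ that contain $\Bbbk$ (equivalently, the closed points of the smooth complete curve with function field $K$), and let $\operatorname{ord}_{\mathfrak q}$ be the normalized valuation at $\mathfrak q$. Let $\operatorname{Pic}K$ be the group of divisors (the free abelian group on $X$) modulo the principal divisors $\sum_{\mathfrak q}\operatorname{ord}_{\mathfrak q}(f)\,\mathfrak q$, $f\in K^\times$, and let $\operatorname{Pic}^0K\subseteq\operatorname{Pic}K$ be the subgroup of classes of divisors of degree $0$, where $\deg\mathfrak q=[\mathcal O_{\mathfrak q}/\mathfrak m_{\mathfrak q}:\Bbbk]$ and $\mathfrak m_{\mathfrak q}$ is the maximal ideal of $\mathcal O_{\mathfrak q}$. For $\mathfrak p\in X$ let $\operatorname{Cl}\mathcal O_{X\setminus\{\mathfrak p\}}$ be the ideal class group of the ring $\mathcal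 O_{X\setminus\{\mathfrak p\}}=\bigcap_{\mathfrak q\in X,\ \mathfrak q\neq\mathfrak p}\mathcal O_{\mathfrak q}$. For an abelian group $A$ write $\operatorname{rk}_2A=\dim_{\mathbb F_2}(A/2A)$. Then for every point $\mathfrak p\in X$ \[ \operatorname{rk}_2\operatorname{Cl}\mathcal O_{X\setminus\{\mathfrak p\}}= \begin{cases} \operatorname{rk}_2\operatorname{Pic}^0K,&\text{if the class of }\mathfrak p\text{ does not lie in }2\operatorname{Pic}K,\\ 1+\operatorname{rk}_2\operatorname{Pic}^0K,&\text{if the class of }\mathfrak p\text{ lies in }2\operatorname{Pic}K. \end{cases} \] -/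

import Mathlib

/-- `K` is a global function field with full field of constants `k`: `k` is a finite field, `K` is
an algebraic function field in one variable over `k` (a finite extension of `k(t)` for some `t`
transcendental over `k`), and every element of `K` that is algebraic over `k` lies in `k`. -/
structure IsGlobalFunctionField (k : Type*) (K : Type*) [Field k] [Field K] [Algebra k K] :
    Prop where
  finite_constants : Finite k
  exists_finite_over_adjoin : ∃ t : K, Transcendental k t ∧
    FiniteDimensional (IntermediateField.adjoin k {t}) K
  constants_full : ∀ x : K, IsAlgebraic k x → x ∈ Set.range (algebraMap k K)

/-- A point (prime, non-trivial place) of the function field `K / k`: a discrete valuation ring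
with field of fractions `K` that contains the constants. -/
@[ext]
structure FFPoint (k : Type*) (K : Type*) [Field k] [Field K] [Algebra k K] where
  /-- The valuation ring of the point. -/
  valRing : ValuationSubring K
  isDVR : IsDiscreteValuationRing valRing
  algebraMap_mem : ∀ a : k, algebraMap k K a ∈ valRing

attribute [instance] FFPoint.isDVR

noncomputable section

namespace FFPoint

variable {k : Type*} {K : Type*} [Field k] [Field K] [Algebra k K]

/-- The valuation ring of a point is an algebra over the constants. -/
instance algebraValRing (p : FFPoint k K) : Algebra k p.valRing :=
  ((algebraMap k K).codRestrict p.valRing p.algebraMap_mem).toAlgebra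

/-- The degree of a point: the dimension of its residue field over the constants. -/
def degree (p : FFPoint k K) : ℕ :=
  Module.finrank k (IsLocalRing.ResidueField p.valRing)

/-- The normalized order function at a point, on non-zero functions. The minus sign turns the
multiplicative `ℤᵐ⁰`-valued valuation of the maximal ideal into the additive one. -/
def ord (p : FFPoint k K) (f : Kˣ) : ℤ :=
  -WithZero.log ((IsDiscreteValuationRing.maximalIdeal p.valRing).valuation K (f : K))

theorem ord_one (p : FFPoint k K) : p.ord 1 = 0 := by
  simp [ord]

theorem ord_mul (p : FFPoint k K) (f g : Kˣ) : p.ord (f * g) = p.ord f + p.ord g := by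
  unfold ord
  rw [Units.val_mul, map_mul, WithZero.log_mul (by simp) (by simp)]
  ring

theorem ord_inv (p : FFPoint k K) (f : Kˣ) : p.ord f⁻¹ = -p.ord f := by
  have h := p.ord_mul f f⁻¹
  rw [mul_inv_cancel, ord_one] at h
  linarith

end FFPoint

section Divisors

variable (k : Type*) (K : Type*) [Field k] [Field K] [Algebra k K]

/-- The group of divisors of `K`: the free abelian group on the points. -/
abbrev FFDiv : Type _ := FFPoint k K →₀ ℤ

/-- The degree of a divisor. -/
def FFDiv.degree : FFDiv k K →+ ℤ :=
  Finsupp.liftAddHom fun p => (AddMonoidHom.mulRight (p.degree : ℤ))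

/-- The subgroup of principal divisors: the divisors `∑ ord_p(f) p` of non-zero functions `f`. -/
def FFDiv.principal : AddSubgroup (FFDiv k K) where
  carrier := {D | ∃ f : Kˣ, ∀ p, D p = p.ord f}
  zero_mem' := ⟨1, fun p => by simp [FFPoint.ord_one]⟩
  add_mem' := by
    rintro D E ⟨f, hf⟩ ⟨g, hg⟩
    exact ⟨f * g, fun p => by simp [FFPoint.ord_mul, hf, hg]⟩
  neg_mem' := by
    rintro D ⟨f, hf⟩
    exact ⟨f⁻¹, fun p => by simp [FFPoint.ord_inv, hf]⟩

/-- The Picard group of `K`: divisors modulo principal divisors. -/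
abbrev FFPic : Type _ := FFDiv k K ⧸ FFDiv.principal k K

/-- The group of classes of divisors of degree zero. -/
def FFPicZero : AddSubgroup (FFPic k K) :=
  (FFDiv.degree k K).ker.map (QuotientAddGroup.mk' (FFDiv.principal k K))

end Divisors

section Points

variable {k : Type*} {K : Type*} [Field k] [Field K] [Algebra k K]

/-- The class of a point in the Picard group. -/
def FFPoint.picClass (p : FFPoint k K) : FFPic k K :=
  QuotientAddGroup.mk' (FFDiv.principal k K) (Finsupp.single p 1)

/-- The ring of functions that are regular at every point of the set `Y`. -/
def regularFunctions (Y : Set (FFPoint k K)) : Subring K :=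
  ⨅ p ∈ Y, p.valRing.toSubring

end Points

/-- The `2`-rank of an abelian group `A`: the dimension of `A / 2A` over the field with two
elements. -/
def twoRank (A : Type*) [AddCommGroup A] : Cardinal :=
  Module.rank (ZMod 2) (ModN A 2)

end

/-! Write `O` for the ring of functions regular away from `p`. Deleting `p` from the curve gives `Cl
O ≅ Pic K / ⟨[p]⟩`, and the rest is linear algebra over `F₂`. For an abelian group `A` and `c ∈ A`,
the kernel of `A/2A → (A/⟨c⟩)/2` is spanned by the class of `c`. So `rk₂` drops by one on passing to
`A/⟨c⟩` if `c ∉ 2A`, and is unchanged otherwise (`twoRank_eq_add_rank_span`). The degree map is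
nonzero on `Pic K` with kernel `Pic⁰ K`, and a nonzero subgroup of `ℤ` is free of rank one, whence
`rk₂ Pic K = rk₂ Pic⁰ K + 1` (`twoRank_eq_twoRank_ker_add_one`).

Two geometric facts are needed. Degree must be defined on classes: both zeros and poles of a
transcendental `x` have total degree `[K : k(x)]`. The upper bound comes from the dimension of
`B/(x)`, with `B` the integral closure of `k[x]` (`sum_ord_mul_degree_le`); the lower bound comes
from the growth of `L(m(x)_∞ + C)` in `m` (`degree_poles`). Moreover `O` must be a Dedekind domain
with fraction field `K` whose maximal ideals are the points other than `p`. This requires enough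
functions with poles only at `p`, supplied by a weak form of Riemann's theorem
(`exists_ne_zero_mem_rrSpace`). -/

namespace IsGlobalFunctionField

/-! ### Finiteness of `K` over `k(x)`. -/

open scoped IntermediateField.algebraAdjoinAdjoin

variable {k : Type*} {K : Type*} [Field k] [Field K] [Algebra k K]

theorem essFiniteType (hK : IsGlobalFunctionField k K) : Algebra.EssFiniteType k K := by
  obtain ⟨t, -, ht⟩ := hK.exists_finite_over_adjoin
  have : Algebra.EssFiniteType k (IntermediateField.adjoin k {t}) :=
    IntermediateField.essFiniteType_iff.mpr ⟨{t}, by simp⟩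
  exact Algebra.EssFiniteType.comp k (IntermediateField.adjoin k {t}) K

/-- The transcendence degree of `K / k` is at most one, so a single transcendental element is
already a transcendence basis. -/
theorem isAlgebraic_adjoin (hK : IsGlobalFunctionField k K) {x : K} (hx : Transcendental k x) :
    Algebra.IsAlgebraic (IntermediateField.adjoin k {x}) K := by
  obtain ⟨t, ht, htf⟩ := hK.exists_finite_over_adjoin
  have h1 : Algebra.IsAlgebraic (Algebra.adjoin k {t}) K :=
    Algebra.IsAlgebraic.trans _ (IntermediateField.adjoin k {t}) _
  have h2 : AlgebraicIndependent k ![x] :=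
    (algebraicIndependent_unique_type_iff (ι := Fin 1)).mpr (by simpa using hx)
  have h3 : Algebra.trdeg k K ≤ 1 := by
    simpa using Algebra.IsAlgebraic.trdeg_le_cardinalMk k ({t} : Set K)
  have h4 := (h2.isTranscendenceBasis_of_lift_trdeg_le_of_finite (by simpa using h3)).isAlgebraic
  rw [Matrix.range_cons, Matrix.range_empty, Set.union_empty] at h4
  exact h4.extendScalars (FaithfulSMul.algebraMap_injective (Algebra.adjoin k {x})
    (IntermediateField.adjoin k {x}))

theorem finiteDimensional_adjoin (hK : IsGlobalFunctionField k K) {x : K}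
    (hx : Transcendental k x) : FiniteDimensional (IntermediateField.adjoin k {x}) K := by
  have := hK.isAlgebraic_adjoin hx
  have := hK.essFiniteType
  have : Algebra.EssFiniteType (IntermediateField.adjoin k {x}) K :=
    Algebra.EssFiniteType.of_comp k _ K
  exact Algebra.finite_of_essFiniteType_of_isAlgebraic

end IsGlobalFunctionField

/-! ### Quotients of subrings of `K`, and a criterion for being Dedekind. -/

section QuotientDimension

open scoped IntermediateField.algebraAdjoinAdjoin in
theorem linearIndependent_adjoin_of_algebraAdjoin {k K ι : Type*} [Field k] [Field K]
    [Algebra k K] {S : Set K} {b : ι → K} (hb : LinearIndependent (Algebra.adjoin k S) b) :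
    LinearIndependent (IntermediateField.adjoin k S) b :=
  (LinearIndependent.iff_fractionRing (Algebra.adjoin k S) (IntermediateField.adjoin k S)).mp hb

variable {k K B : Type*} [Field k] [Field K] [Algebra k K] [CommRing B] [Algebra k B]
  [Algebra B K] [IsScalarTower k B K] [FaithfulSMul B K]

-- Descent along powers of `f`: modulo `f` the relation involves only constant coefficients, which
-- vanish by independence. Cancelling `f` leaves a relation of the same shape.
open Polynomial in
theorem X_pow_dvd_of_sum_aeval_mul_eq_zero [IsDomain B] {ι : Type*} [Fintype ι] {f : B}
    (hf : f ≠ 0) {b : ι → B}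
    (hb : LinearIndependent k fun i => Ideal.Quotient.mk (Ideal.span {f}) (b i)) (N : ℕ) :
    ∀ P : ι → k[X], ∑ i, aeval f (P i) * b i = 0 → ∀ i, X ^ N ∣ P i := by
  induction N with
  | zero => simp
  | succ N ih =>
    intro P hP
    have key (i) : aeval f (P i) = f * aeval f (divX (P i)) + algebraMap k B ((P i).coeff 0) := by
      conv_lhs => rw [← X_mul_divX_add (P i)]
      simp only [map_add, map_mul, aeval_X, aeval_C]
    have h0 : ∀ i, (P i).coeff 0 = 0 := by
      refine Fintype.linearIndependent_iff.mp hb _ ?_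
      have h := congrArg (Ideal.Quotient.mk (Ideal.span {f})) hP
      have hfz : Ideal.Quotient.mk (Ideal.span {f}) f = 0 := by simp
      simpa [key, hfz, map_sum, Algebra.smul_def, add_mul] using h
    have h1 : ∑ i, aeval f (divX (P i)) * b i = 0 := by
      refine (mul_eq_zero.mp (?_ : f * _ = 0)).resolve_left hf
      rw [Finset.mul_sum, ← hP]
      exact Finset.sum_congr rfl fun i _ => by rw [key, h0]; simp [mul_assoc]
    intro i
    rw [← X_mul_divX_add (P i), h0, map_zero, add_zero, pow_succ']
    exact mul_dvd_mul_left _ (ih _ h1 i)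

/-- Over `k[f]` a relation has polynomial coefficients divisible by every power of `X`, hence zero.
Clearing denominators passes to `k(f)`, so `dim B/(f)` is bounded by `[K : k(f)]`. -/
theorem linearIndependent_adjoin_of_quotient {ι : Type*} [Finite ι] {f : B}
    (hf : Transcendental k (algebraMap B K f)) {b : ι → B}
    (hb : LinearIndependent k fun i => Ideal.Quotient.mk (Ideal.span {f}) (b i)) :
    LinearIndependent (IntermediateField.adjoin k {algebraMap B K f})
      fun i => algebraMap B K (b i) := by
  have := Fintype.ofFinite ι
  have hinj := FaithfulSMul.algebraMap_injective B K
  have : IsDomain B := hinj.isDomain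
  refine linearIndependent_adjoin_of_algebraAdjoin ?_
  rw [Fintype.linearIndependent_iff]
  intro g hg
  have hP (i) : ∃ P : Polynomial k, Polynomial.aeval (algebraMap B K f) P = (g i : K) := by
    simpa [Algebra.adjoin_singleton_eq_range_aeval] using (g i).2
  choose P hP using hP
  have h0 : ∑ i, Polynomial.aeval f (P i) * b i = 0 := by
    apply hinj
    rw [map_sum, map_zero, ← hg]
    refine Finset.sum_congr rfl fun i _ => ?_
    rw [map_mul, ← Polynomial.aeval_algebraMap_apply, hP, Algebra.smul_def]
    rfl
  have hf0 : f ≠ 0 := fun h => hf (by rw [h, map_zero]; exact isAlgebraic_zero)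
  intro i
  have hPi : P i = 0 := by
    by_contra hne
    have h := Polynomial.natDegree_le_of_dvd
      (X_pow_dvd_of_sum_aeval_mul_eq_zero hf0 hb ((P i).natDegree + 1) P h0 i) hne
    simp at h
  exact Subtype.ext (by rw [← hP, hPi]; simp)

theorem rank_quotient_span_singleton_le (hK : IsGlobalFunctionField k K) {f : B}
    (hf : Transcendental k (algebraMap B K f)) :
    Module.rank k (B ⧸ Ideal.span {f}) ≤
      (Module.finrank (IntermediateField.adjoin k {algebraMap B K f}) K : ℕ) := by
  have := hK.finiteDimensional_adjoin hf
  refine rank_le fun s hs => ?_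
  have h := linearIndependent_adjoin_of_quotient (K := K) (ι := s) hf
    (b := fun i => Function.surjInv Ideal.Quotient.mk_surjective i.1) (by
      simpa only [Function.surjInv_eq] using hs)
  simpa using h.fintype_card_le_finrank

theorem IsGlobalFunctionField.finiteDimensional_quotient_span_singleton
    (hK : IsGlobalFunctionField k K) {f : B} (hf : f ≠ 0) :
    FiniteDimensional k (B ⧸ Ideal.span {f}) := by
  by_cases h : IsAlgebraic k (algebraMap B K f)
  · obtain ⟨a, ha⟩ := hK.constants_full _ h
    have hfa : f = algebraMap k B a := by
      apply FaithfulSMul.algebraMap_injective B K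
      rw [← ha, ← IsScalarTower.algebraMap_apply]
    have ha0 : a ≠ 0 := by rintro rfl; exact hf (by simpa using hfa)
    have hu : IsUnit f := hfa ▸ (IsUnit.mk0 a ha0).map _
    rw [Ideal.span_singleton_eq_top.mpr hu]
    infer_instance
  · exact Module.rank_lt_aleph0_iff.mp
      ((rank_quotient_span_singleton_le hK h).trans_lt Cardinal.natCast_lt_aleph0)

namespace IsGlobalFunctionField

theorem finiteDimensional_quotient (hK : IsGlobalFunctionField k K) {I : Ideal B} (hI : I ≠ ⊥) :
    FiniteDimensional k (B ⧸ I) := by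
  obtain ⟨f, hfI, hf⟩ := Submodule.exists_mem_ne_zero_of_ne_bot hI
  have := hK.finiteDimensional_quotient_span_singleton hf
  have hle : Ideal.span {f} ≤ I := (Ideal.span_singleton_le_iff_mem I).mpr hfI
  exact Module.Finite.of_surjective (Ideal.Quotient.factorₐ k hle).toLinearMap
    (Ideal.Quotient.factor_surjective hle)

variable (B)

/-- For `0 ≠ f ∈ I`, the image of `I` in the finite-dimensional space `B/(f)` is finitely generated,
and the kernel `(f)` is too. -/
theorem isNoetherianRing (hK : IsGlobalFunctionField k K) : IsNoetherianRing B := by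
  refine ⟨fun I => ?_⟩
  by_cases hI : I = ⊥
  · exact hI ▸ Submodule.fg_bot
  obtain ⟨f, hfI, hf⟩ := Submodule.exists_mem_ne_zero_of_ne_bot hI
  have := hK.finiteDimensional_quotient_span_singleton hf
  have : IsNoetherian B (B ⧸ Ideal.span {f}) := isNoetherian_of_tower k inferInstance
  refine Submodule.fg_of_fg_map_of_fg_inf_ker (Submodule.mkQ (Ideal.span {f}))
    (IsNoetherian.noetherian _) ?_
  rw [Submodule.ker_mkQ, inf_eq_right.mpr ((Ideal.span_singleton_le_iff_mem I).mpr hfI)]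
  exact Submodule.fg_span_singleton f

theorem dimensionLEOne (hK : IsGlobalFunctionField k K) : Ring.DimensionLEOne B := by
  refine ⟨fun {P} hP hPr => ?_⟩
  have := hK.finiteDimensional_quotient hP
  exact Ideal.Quotient.maximal_of_isField P
    (isField_of_isIntegral_of_isField' (R := k) (Field.toIsField k))

theorem isDedekindDomain [IsIntegrallyClosed B] (hK : IsGlobalFunctionField k K) :
    IsDedekindDomain B := by
  have := (FaithfulSMul.algebraMap_injective B K).isDomain
  have := hK.isNoetherianRing B
  have := hK.dimensionLEOne B
  exact { }

end IsGlobalFunctionField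

end QuotientDimension

/-! ### Points as maximal ideals of Dedekind subrings. -/

section Places

open IsDedekindDomain

theorem Valuation.IsEquiv.eq_of_surjective {K : Type*} [Field K]
    {v w : Valuation K (WithZero (Multiplicative ℤ))} (h : v.IsEquiv w)
    (hv : Function.Surjective v) (hw : Function.Surjective w) : v = w := by
  obtain ⟨π, hπ⟩ := hv (WithZero.exp (-1))
  obtain ⟨y, hy⟩ := hw (WithZero.exp (-1))
  have hπ0 : π ≠ 0 := by rintro rfl; rw [map_zero] at hπ; exact WithZero.exp_ne_zero hπ.symm
  have key (x : K) (hx : x ≠ 0) : w x = w π ^ (-WithZero.log (v x)) := by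
    have h1 : v (x / π ^ (-WithZero.log (v x))) = 1 := by
      rw [map_div₀, map_zpow₀, hπ, ← WithZero.exp_zsmul]
      have : v x ≠ 0 := by simpa using hx
      simp [WithZero.exp_log this, this]
    have h2 := h.eq_one_iff_eq_one.mp h1
    rw [map_div₀, map_zpow₀] at h2
    have h3 : w π ^ (-WithZero.log (v x)) ≠ 0 := zpow_ne_zero _ (by simpa using hπ0)
    exact (div_eq_one_iff_eq h3).mp h2
  have hwπ : w π ≠ 0 := by simpa using hπ0
  have hlt : w π < 1 := h.lt_one_iff_lt_one.mp (by
    rw [hπ, ← WithZero.exp_zero, WithZero.exp_lt_exp]; omega)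
  have hlog : WithZero.log (w π) < 0 := by
    rw [← WithZero.log_one]
    exact (WithZero.log_lt_log hwπ one_ne_zero).mpr hlt
  have hy0 : y ≠ 0 := by rintro rfl; rw [map_zero] at hy; exact WithZero.exp_ne_zero hy.symm
  have h4 : WithZero.log (w π) = -1 := by
    have h5 := congrArg WithZero.log (key y hy0)
    rw [hy, WithZero.log_exp, WithZero.log_zpow] at h5
    -- All values of `w` are powers of `w π`, and `w` attains `exp (-1)`; hence `log (w π)` divides
    -- `-1`, and its sign is known.
    have h6 : IsUnit (WithZero.log (w π)) :=
      IsUnit.of_mul_eq_one (WithZero.log (v y)) (by simp at h5 ⊢; linarith)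
    rcases Int.isUnit_iff.mp h6 with h | h <;> omega
  ext x
  by_cases hx : x = 0
  · simp [hx]
  · have hvx : v x ≠ 0 := by simpa using hx
    rw [key x hx, ← WithZero.exp_log hwπ, h4, ← WithZero.exp_zsmul]
    simp [WithZero.exp_log hvx]

namespace FFPoint

variable {k K : Type*} [Field k] [Field K] [Algebra k K] (q : FFPoint k K)

/-- The normalized multiplicative valuation of a point. -/
noncomputable def val : Valuation K (WithZero (Multiplicative ℤ)) :=
  (IsDiscreteValuationRing.maximalIdeal q.valRing).valuation K

theorem ord_eq (f : Kˣ) : q.ord f = -WithZero.log (q.val f) := rfl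

theorem val_eq_exp (f : Kˣ) : q.val f = WithZero.exp (-q.ord f) := by
  rw [ord_eq, neg_neg, WithZero.exp_log (by simp)]

theorem val_surjective : Function.Surjective q.val :=
  (IsDiscreteValuationRing.maximalIdeal q.valRing).valuation_surjective K

theorem val_le_one_iff {f : K} : q.val f ≤ 1 ↔ f ∈ q.valRing := by
  constructor
  · intro h
    obtain ⟨a, rfl⟩ := IsDiscreteValuationRing.exists_lift_of_le_one h
    exact a.2
  · intro h
    exact (IsDiscreteValuationRing.maximalIdeal q.valRing).valuation_le_one (K := K) ⟨f, h⟩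

theorem val_lt_one_iff {f : q.valRing} :
    q.val f < 1 ↔ f ∈ IsLocalRing.maximalIdeal q.valRing :=
  (IsDiscreteValuationRing.maximalIdeal q.valRing).valuation_lt_one_iff_mem (K := K) f

theorem valuationSubring_val : q.val.valuationSubring = q.valRing := by
  ext f
  exact q.val_le_one_iff

theorem valRing_ne_top : q.valRing ≠ ⊤ := by
  intro h
  obtain ⟨f, hf⟩ := q.val_surjective (WithZero.exp 1)
  have h1 : q.val f ≤ 1 := q.val_le_one_iff.mpr (h ▸ ValuationSubring.mem_top f)
  rw [hf, ← WithZero.exp_zero, WithZero.exp_le_exp] at h1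
  omega

section Dedekind

variable (B : Type*) [CommRing B] [IsDedekindDomain B] [Algebra B K] [IsFractionRing B K]

/-- The centre, on a Dedekind domain `B` with fraction field `K`, of a point whose valuation ring
contains `B`. -/
noncomputable def centre (h : ∀ b, algebraMap B K b ∈ q.valRing) : HeightOneSpectrum B where
  asIdeal := (IsLocalRing.maximalIdeal q.valRing).comap ((algebraMap B K).codRestrict q.valRing h)
  isPrime := Ideal.comap_isPrime _ _
  ne_bot := by
    intro h0
    -- With zero centre every nonzero element of `B` would be a unit at `q`, so the valuation ring
    -- would be all of `K`.
    refine q.valRing_ne_top (top_le_iff.mp fun f _ => ?_)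
    obtain ⟨a, b, hb, rfl⟩ := IsFractionRing.div_surjective (A := B) f
    have hb0 : b ∉ (IsLocalRing.maximalIdeal q.valRing).comap
        ((algebraMap B K).codRestrict q.valRing h) := by
      rw [h0]; simpa using nonZeroDivisors.ne_zero hb
    rw [Ideal.mem_comap, ← val_lt_one_iff] at hb0
    have hb1 : q.val (algebraMap B K b) = 1 :=
      le_antisymm (q.val_le_one_iff.mpr (h b)) (not_lt.mp hb0)
    rw [← val_le_one_iff, map_div₀, hb1, div_one]
    exact q.val_le_one_iff.mpr (h a)

variable {B}

theorem mem_centre (h : ∀ b, algebraMap B K b ∈ q.valRing) {b : B} :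
    b ∈ (q.centre B h).asIdeal ↔ q.val (algebraMap B K b) < 1 :=
  Ideal.mem_comap.trans q.val_lt_one_iff.symm

/-- The localization at the centre is a discrete valuation ring, so no ring lies strictly between it
and `K`; one inclusion suffices. -/
theorem valuationSubringAtPrime_centre (h : ∀ b, algebraMap B K b ∈ q.valRing) :
    (q.centre B h).valuationSubringAtPrime K = q.valRing := by
  refine ValuationSubring.eq_of_le_of_ne_top _ (fun f hf => ?_) q.valRing_ne_top
  rw [HeightOneSpectrum.valuationSubringAtPrime_eq_valuationSubring] at hf
  obtain ⟨n, d, hd⟩ := HeightOneSpectrum.exists_primeCompl_mul_eq_of_integer _ f hf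
  have h1 : q.val (algebraMap B K d) = 1 :=
    le_antisymm (q.val_le_one_iff.mpr (h _)) (not_lt.mp fun hlt => d.2 ((q.mem_centre h).mpr hlt))
  rw [← val_le_one_iff]
  have h2 := q.val_le_one_iff.mpr (h n)
  rwa [← hd, map_mul, h1, mul_one] at h2

theorem valuation_centre (h : ∀ b, algebraMap B K b ∈ q.valRing) :
    (q.centre B h).valuation K = q.val := by
  refine Valuation.IsEquiv.eq_of_surjective ?_ ((q.centre B h).valuation_surjective K)
    q.val_surjective
  rw [Valuation.isEquiv_iff_valuationSubring, valuationSubring_val,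
    ← HeightOneSpectrum.valuationSubringAtPrime_eq_valuationSubring,
    valuationSubringAtPrime_centre]

variable [Algebra k B] [IsScalarTower k B K]

/-- The point attached to a maximal ideal of a Dedekind domain with fraction field `K`. -/
noncomputable def ofPrime (P : HeightOneSpectrum B) : FFPoint k K where
  valRing := P.valuationSubringAtPrime K
  isDVR := IsLocalization.AtPrime.isDiscreteValuationRing_of_dedekind_domain B P.ne_bot _
  algebraMap_mem a := by
    rw [HeightOneSpectrum.valuationSubringAtPrime_eq_valuationSubring,
      IsScalarTower.algebraMap_apply k B K]
    exact P.valuation_le_one _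

theorem algebraMap_mem_ofPrime (P : HeightOneSpectrum B) (b : B) :
    algebraMap B K b ∈ (ofPrime P : FFPoint k K).valRing := by
  change _ ∈ P.valuationSubringAtPrime K
  rw [HeightOneSpectrum.valuationSubringAtPrime_eq_valuationSubring]
  exact P.valuation_le_one _

theorem val_ofPrime (P : HeightOneSpectrum B) :
    (ofPrime P : FFPoint k K).val = P.valuation K := by
  refine Valuation.IsEquiv.eq_of_surjective ?_ (val_surjective _) (P.valuation_surjective K)
  rw [Valuation.isEquiv_iff_valuationSubring, valuationSubring_val,
    ← HeightOneSpectrum.valuationSubringAtPrime_eq_valuationSubring]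
  rfl

variable (k K B) in
/-- The points whose valuation rings contain a Dedekind domain `B` with fraction field `K`
correspond to the maximal ideals of `B`. -/
noncomputable def equivHeightOneSpectrum :
    {q : FFPoint k K // ∀ b, algebraMap B K b ∈ q.valRing} ≃ HeightOneSpectrum B where
  toFun q := q.1.centre B q.2
  invFun P := ⟨ofPrime P, algebraMap_mem_ofPrime P⟩
  left_inv q := by
    ext1
    exact FFPoint.ext (q.1.valuationSubringAtPrime_centre q.2)
  right_inv P := by
    apply HeightOneSpectrum.eq_of_valuation_isEquiv_valuation (K := K)
    rw [valuation_centre, val_ofPrime]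

/-- Reduction modulo a point, on a `k`-algebra contained in its valuation ring. -/
noncomputable def reduction (h : ∀ b, algebraMap B K b ∈ q.valRing) :
    B →ₐ[k] IsLocalRing.ResidueField q.valRing where
  toRingHom := (IsLocalRing.residue q.valRing).comp ((algebraMap B K).codRestrict q.valRing h)
  commutes' a := congrArg (IsLocalRing.residue q.valRing)
    (Subtype.ext (IsScalarTower.algebraMap_apply k B K a).symm)

theorem ker_reduction (h : ∀ b, algebraMap B K b ∈ q.valRing) :
    RingHom.ker (q.reduction h) = (q.centre B h).asIdeal := by
  ext b
  rw [RingHom.mem_ker, mem_centre]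
  exact (IsLocalRing.residue_eq_zero_iff _).trans q.val_lt_one_iff.symm

theorem reduction_surjective (h : ∀ b, algebraMap B K b ∈ q.valRing) :
    Function.Surjective (q.reduction h) := by
  intro y
  obtain ⟨f, rfl⟩ := IsLocalRing.residue_surjective y
  have hf : (q.centre B h).valuation K f ≤ 1 := by
    rw [valuation_centre]; exact q.val_le_one_iff.mpr f.2
  -- `B` is dense in the valuation ring, so `f` is congruent to some `b` modulo the maximal ideal.
  obtain ⟨b, hb⟩ := HeightOneSpectrum.exists_valuation_sub_lt_of_integer _ hf 1
  refine ⟨b, sub_eq_zero.mp ?_⟩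
  rw [valuation_centre] at hb
  exact (map_sub (IsLocalRing.residue q.valRing) _ _).symm.trans
    ((IsLocalRing.residue_eq_zero_iff _).mpr (q.val_lt_one_iff.mp hb))

/-- The residue field of a point is the residue ring at its centre. -/
noncomputable def quotientCentreEquiv (h : ∀ b, algebraMap B K b ∈ q.valRing) :
    (B ⧸ (q.centre B h).asIdeal) ≃ₐ[k] IsLocalRing.ResidueField q.valRing :=
  (Ideal.quotientEquivAlgOfEq k (q.ker_reduction h).symm).trans
    (Ideal.quotientKerAlgEquivOfSurjective (q.reduction_surjective h))

end Dedekind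

end FFPoint

end Places

/-! ### Zeros of a function and their total degree. -/

section Zeros

open IsDedekindDomain

/-- The integral closure of `k[x]` in `K`. -/
noncomputable def integralClosureAdjoin (k : Type*) {K : Type*} [Field k] [Field K] [Algebra k K]
    (x : K) : Subalgebra k K :=
  (integralClosure (Algebra.adjoin k {x}) K).restrictScalars k

section IntegralClosureAdjoin

variable {k K : Type*} [Field k] [Field K] [Algebra k K]

theorem self_mem_integralClosureAdjoin (x : K) : x ∈ integralClosureAdjoin k x :=
  isIntegral_algebraMap (x := (⟨x, Algebra.self_mem_adjoin_singleton k x⟩ : Algebra.adjoin k {x}))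

open scoped IntermediateField.algebraAdjoinAdjoin in
theorem IsGlobalFunctionField.isFractionRing_integralClosureAdjoin
    (hK : IsGlobalFunctionField k K) {x : K} (hx : Transcendental k x) :
    IsFractionRing (integralClosureAdjoin k x) K := by
  have := hK.isAlgebraic_adjoin hx
  have : Algebra.IsAlgebraic (Algebra.adjoin k {x}) K :=
    Algebra.IsAlgebraic.trans _ (IntermediateField.adjoin k {x}) _
  exact integralClosure.isFractionRing_of_algebraic (A := Algebra.adjoin k {x}) (L := K)
    fun y hy => (Subtype.ext hy)

theorem IsGlobalFunctionField.isDedekindDomain_integralClosureAdjoin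
    (hK : IsGlobalFunctionField k K) {x : K} (hx : Transcendental k x) :
    IsDedekindDomain (integralClosureAdjoin k x) := by
  have := hK.isFractionRing_integralClosureAdjoin hx
  have : IsIntegrallyClosed (integralClosureAdjoin k x) :=
    (isIntegrallyClosed_iff_isIntegrallyClosedIn K).mpr
      (inferInstanceAs (IsIntegrallyClosedIn (integralClosure (Algebra.adjoin k {x}) K) K))
  exact hK.isDedekindDomain _

/-- Invertibility descends along the integral extension to `k[x]`, where an inverse `P(x)` would
make `x` a root of `X * P - 1`. This is what gives `x` a zero. -/
theorem not_isUnit_integralClosureAdjoin {x : K} (hx : Transcendental k x) :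
    ¬ IsUnit (⟨x, self_mem_integralClosureAdjoin x⟩ : integralClosureAdjoin k x) := by
  intro hu
  have h : IsUnit (⟨x, Algebra.self_mem_adjoin_singleton k x⟩ : Algebra.adjoin k {x}) := by
    have : FaithfulSMul (Algebra.adjoin k {x}) (integralClosure (Algebra.adjoin k {x}) K) :=
      (faithfulSMul_iff_algebraMap_injective _ _).mpr fun y z h =>
        Subtype.ext (congrArg (algebraMap (integralClosure (Algebra.adjoin k {x}) K) K) h)
    refine isUnit_of_map_unit (algebraMap (Algebra.adjoin k {x})
      (integralClosure (Algebra.adjoin k {x}) K)) _ hu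
  obtain ⟨⟨y, hy⟩, hxy⟩ := h.exists_right_inv
  rw [Algebra.adjoin_singleton_eq_range_aeval] at hy
  obtain ⟨P, rfl⟩ := hy
  have h1 : x * Polynomial.aeval x P = 1 := congrArg Subtype.val hxy
  refine hx ⟨Polynomial.X * P - 1, fun h0 => ?_, by simp [h1]⟩
  simpa using congrArg (Polynomial.eval 0) h0

end IntegralClosureAdjoin

namespace FFPoint

variable {k K : Type*} [Field k] [Field K] [Algebra k K] (q : FFPoint k K)

theorem mem_valRing_of_isIntegral {A : Type*} [CommRing A] [Algebra A K]
    (h : ∀ a, algebraMap A K a ∈ q.valRing) {x : K} (hx : IsIntegral A x) : x ∈ q.valRing := by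
  let f : A →+* q.valRing := (algebraMap A K).codRestrict q.valRing h
  obtain ⟨P, hP, hPx⟩ := hx
  have hint : IsIntegral q.valRing x := by
    refine ⟨P.map f, hP.map f, ?_⟩
    rw [Polynomial.eval₂_map]
    exact hPx
  obtain ⟨c, hc⟩ := IsIntegrallyClosed.isIntegral_iff.mp hint
  exact hc ▸ c.2

theorem integralClosureAdjoin_le {x : K} (hx : x ∈ q.valRing)
    (b : integralClosureAdjoin k x) : algebraMap _ K b ∈ q.valRing := by
  refine q.mem_valRing_of_isIntegral (A := Algebra.adjoin k {x}) ?_ b.2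
  rintro ⟨y, hy⟩
  change y ∈ q.valRing
  induction hy using Algebra.adjoin_induction with
  | mem z hz => exact (Set.mem_singleton_iff.mp hz) ▸ hx
  | algebraMap a => exact q.algebraMap_mem a
  | add y z _ _ hy hz => exact add_mem hy hz
  | mul y z _ _ hy hz => exact mul_mem hy hz

theorem val_algebraMap {a : k} (ha : a ≠ 0) : q.val (algebraMap k K a) = 1 := by
  refine le_antisymm (q.val_le_one_iff.mpr (q.algebraMap_mem a)) ?_
  have h := q.val_le_one_iff.mpr (q.algebraMap_mem a⁻¹)
  rwa [map_inv₀, map_inv₀, inv_le_one₀ (zero_lt_iff.mpr (by simpa using ha))] at h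

theorem transcendental_of_val_ne_one (hK : IsGlobalFunctionField k K) {x : K} (hx : x ≠ 0)
    (h : q.val x ≠ 1) : Transcendental k x := by
  intro ha
  obtain ⟨a, rfl⟩ := hK.constants_full x ha
  exact h (q.val_algebraMap (by rintro rfl; simp at hx))

theorem exists_uniformizer : ∃ π : K, π ≠ 0 ∧ q.val π = WithZero.exp (-1) := by
  obtain ⟨π, hπ⟩ := q.val_surjective (WithZero.exp (-1))
  exact ⟨π, by rintro rfl; rw [map_zero] at hπ; exact WithZero.exp_ne_zero hπ.symm, hπ⟩

theorem exp_neg_lt_one {n : ℤ} (hn : 0 < n) :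
    (WithZero.exp (-n) : WithZero (Multiplicative ℤ)) < 1 := by
  rw [← WithZero.exp_zero, WithZero.exp_lt_exp]; omega

/-- With `π` a uniformizer, the residue field is a quotient of the integral closure of `k[π]` by a
nonzero ideal. -/
theorem finiteDimensional_residueField (hK : IsGlobalFunctionField k K) :
    FiniteDimensional k (IsLocalRing.ResidueField q.valRing) := by
  obtain ⟨π, hπ0, hπ⟩ := q.exists_uniformizer
  have hlt : q.val π < 1 := hπ ▸ exp_neg_lt_one one_pos
  have ht := q.transcendental_of_val_ne_one hK hπ0 hlt.ne
  have := hK.isFractionRing_integralClosureAdjoin ht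
  have := hK.isDedekindDomain_integralClosureAdjoin ht
  have hmem := q.integralClosureAdjoin_le (q.val_le_one_iff.mp hlt.le)
  have := hK.finiteDimensional_quotient (q.centre _ hmem).ne_bot
  exact Module.Finite.equiv (q.quotientCentreEquiv hmem).toLinearEquiv

theorem degree_pos (hK : IsGlobalFunctionField k K) : 0 < q.degree := by
  have := q.finiteDimensional_residueField hK
  exact Module.finrank_pos

theorem ord_pos_iff {x : Kˣ} : 0 < q.ord x ↔ q.val (x : K) < 1 := by
  rw [val_eq_exp, ← WithZero.exp_zero, WithZero.exp_lt_exp]; omega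

theorem ord_nonneg_iff {x : Kˣ} : 0 ≤ q.ord x ↔ q.val (x : K) ≤ 1 := by
  rw [val_eq_exp, ← WithZero.exp_zero, WithZero.exp_le_exp]; omega

theorem exists_val_lt_one {B : Type*} [CommRing B] [IsDedekindDomain B] [Algebra B K]
    [IsFractionRing B K] [Algebra k B] [IsScalarTower k B K] {b : B} (hb : b ≠ 0)
    (hu : ¬ IsUnit b) : ∃ q : FFPoint k K, q.val (algebraMap B K b) < 1 := by
  obtain ⟨P, hP, hbP⟩ := exists_max_ideal_of_mem_nonunits (mem_nonunits_iff.mpr hu)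
  have hP0 : P ≠ ⊥ := by
    rintro rfl
    exact hb (Ideal.mem_bot.mp hbP)
  refine ⟨ofPrime (⟨P, hP.isPrime, hP0⟩ : HeightOneSpectrum B), ?_⟩
  rw [val_ofPrime]
  exact (HeightOneSpectrum.valuation_lt_one_iff_mem _ _).mpr hbP

theorem exists_ord_pos (hK : IsGlobalFunctionField k K) {x : Kˣ}
    (hx : Transcendental k (x : K)) : ∃ q : FFPoint k K, 0 < q.ord x := by
  have := hK.isFractionRing_integralClosureAdjoin hx
  have := hK.isDedekindDomain_integralClosureAdjoin hx
  obtain ⟨q, hq⟩ := exists_val_lt_one (k := k) (K := K)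
    (fun h => x.ne_zero (congrArg Subtype.val h)) (not_isUnit_integralClosureAdjoin hx)
  exact ⟨q, q.ord_pos_iff.mpr hq⟩

theorem finite_setOf_ord_pos (hK : IsGlobalFunctionField k K) {x : Kˣ}
    (hx : Transcendental k (x : K)) : {q : FFPoint k K | 0 < q.ord x}.Finite := by
  have := hK.isFractionRing_integralClosureAdjoin hx
  have := hK.isDedekindDomain_integralClosureAdjoin hx
  let f : integralClosureAdjoin k (x : K) := ⟨x, self_mem_integralClosureAdjoin _⟩
  have hf : Ideal.span {f} ≠ 0 := by
    rw [Ne, Ideal.zero_eq_bot, Ideal.span_singleton_eq_bot]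
    exact fun h => x.ne_zero (congrArg Subtype.val h)
  refine ((Ideal.finite_factors hf).image fun P => (ofPrime P : FFPoint k K)).subset ?_
  intro q hq
  rw [Set.mem_ofPred_eq, ord_pos_iff] at hq
  have hmem := q.integralClosureAdjoin_le (q.val_le_one_iff.mp hq.le)
  refine ⟨q.centre _ hmem, ?_, FFPoint.ext (q.valuationSubringAtPrime_centre hmem)⟩
  rw [Set.mem_ofPred_eq, Ideal.dvd_span_singleton, mem_centre]
  exact hq

theorem finite_setOf_ord_ne_zero (hK : IsGlobalFunctionField k K) (x : Kˣ) :
    {q : FFPoint k K | q.ord x ≠ 0}.Finite := by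
  by_cases hx : Transcendental k (x : K)
  · have hx' : Transcendental k ((x⁻¹ : Kˣ) : K) := by
      rw [Units.val_inv_eq_inv_val]
      exact fun h => hx (IsAlgebraic.inv_iff.mp h)
    refine ((finite_setOf_ord_pos hK hx).union (finite_setOf_ord_pos hK hx')).subset fun q hq => ?_
    simp only [Set.mem_ofPred_eq, Set.mem_union, ord_inv] at hq ⊢
    omega
  · convert! Set.finite_empty
    ext q
    simp only [Set.mem_ofPred_eq, Set.mem_empty_iff_false, iff_false, not_not]
    by_contra h
    refine hx (q.transcendental_of_val_ne_one hK x.ne_zero fun h1 => h ?_)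
    rw [ord_eq, h1, WithZero.log_one, neg_zero]

theorem cardQuot_prod_pow {B ι : Type*} [CommRing B] [IsDedekindDomain B] (S : Finset ι)
    (P : ι → HeightOneSpectrum B) (hP : Set.InjOn P S) (e : ι → ℕ) :
    Submodule.cardQuot (∏ i ∈ S, (P i).asIdeal ^ e i) =
      ∏ i ∈ S, Submodule.cardQuot (P i).asIdeal ^ e i := by
  classical
  induction S using Finset.induction_on with
  | empty => simp [Ideal.one_eq_top]
  | insert i S hi ih =>
    rw [Finset.prod_insert hi, Finset.prod_insert hi, cardQuot_mul_of_coprime,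
      ih (hP.mono (by simp)), cardQuot_pow_of_prime (P i).ne_bot]
    refine IsCoprime.prod_right fun j hj => IsCoprime.pow ?_
    have := (P i).isMaximal
    have := (P j).isMaximal
    refine Ideal.isCoprime_of_isMaximal fun h => hi ?_
    rwa [hP (by simp) (by simp [hj]) (HeightOneSpectrum.ext h)]

/-- In the integral closure `B` of `k[x]`, the coprime prime powers `P_q ^ ord_q x` have product `J`
dividing `(x)`, so `B/J` is a quotient of `B/(x)`. As `k` is finite, dimensions are compared through
cardinalities, which are multiplicative. -/
theorem sum_ord_mul_degree_le (hK : IsGlobalFunctionField k K) {x : Kˣ}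
    (hx : Transcendental k (x : K)) (S : Finset (FFPoint k K)) (hS : ∀ q ∈ S, 0 < q.ord x) :
    ∑ q ∈ S, q.ord x * q.degree ≤
      Module.finrank (IntermediateField.adjoin k {(x : K)}) K := by
  have := hK.isFractionRing_integralClosureAdjoin hx
  have := hK.isDedekindDomain_integralClosureAdjoin hx
  have := hK.finite_constants
  let f : integralClosureAdjoin k (x : K) := ⟨x, self_mem_integralClosureAdjoin _⟩
  have hf : f ≠ 0 := fun h => x.ne_zero (congrArg Subtype.val h)
  have hmem (q : S) := q.1.integralClosureAdjoin_le
    (q.1.val_le_one_iff.mp (q.1.ord_pos_iff.mp (hS q q.2)).le)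
  let P (q : S) := q.1.centre _ (hmem q)
  have hPinj : Function.Injective P := by
    intro q r h
    refine Subtype.ext (FFPoint.ext ?_)
    rw [← q.1.valuationSubringAtPrime_centre (hmem q),
      ← r.1.valuationSubringAtPrime_centre (hmem r)]
    exact congrArg _ h
  let J := ∏ q : S, (P q).asIdeal ^ (q.1.ord x).toNat
  have hJ : Ideal.span {f} ≤ J := by
    rw [← Ideal.dvd_iff_le]
    refine Finset.prod_dvd_of_coprime (fun q _ r _ hqr => ?_) fun q _ => ?_
    · have := (P q).isMaximal
      have := (P r).isMaximal
      exact (Ideal.isCoprime_of_isMaximal fun h => hqr (hPinj (HeightOneSpectrum.ext h))).pow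
    · rw [← HeightOneSpectrum.intValuation_le_pow_iff_dvd,
        ← HeightOneSpectrum.valuation_of_algebraMap (K := K), valuation_centre]
      change q.1.val (x : K) ≤ _
      rw [val_eq_exp, Int.toNat_of_nonneg (hS q q.2).le]
  have hfin := hK.finiteDimensional_quotient_span_singleton hf
  have hfinite : Finite (integralClosureAdjoin k (x : K) ⧸ Ideal.span {f}) :=
    Module.finite_of_finite k
  have hcard : Submodule.cardQuot J ≤ Nat.card (integralClosureAdjoin k (x : K) ⧸ Ideal.span {f}) :=
    Nat.card_le_card_of_surjective _ (Ideal.Quotient.factor_surjective hJ)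
  have hq (q : S) : Submodule.cardQuot (P q).asIdeal = Nat.card k ^ q.1.degree := by
    have := q.1.finiteDimensional_residueField hK
    rw [Submodule.cardQuot_apply, Nat.card_congr (q.1.quotientCentreEquiv (hmem q)).toEquiv,
      Module.natCard_eq_pow_finrank (K := k)]
    rfl
  rw [cardQuot_prod_pow _ _ hPinj.injOn, Module.natCard_eq_pow_finrank (K := k)] at hcard
  simp_rw [hq, ← pow_mul] at hcard
  rw [Finset.prod_pow_eq_pow_sum, Nat.pow_le_pow_iff_right Finite.one_lt_card] at hcard
  have hle : Module.finrank k (integralClosureAdjoin k (x : K) ⧸ Ideal.span {f}) ≤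
      Module.finrank (IntermediateField.adjoin k {(x : K)}) K :=
    Module.finrank_le_of_rank_le (rank_quotient_span_singleton_le hK (f := f) hx)
  have h := Int.ofNat_le.mpr (hcard.trans hle)
  refine le_trans (le_of_eq ?_) h
  rw [← Finset.sum_coe_sort]
  push_cast
  refine Finset.sum_congr rfl fun q _ => ?_
  rw [Int.toNat_of_nonneg (hS q q.2).le, mul_comm]

end FFPoint

end Zeros

/-! ### Riemann-Roch spaces and upper bounds for their dimension. -/

section RiemannRochSpace

variable {k K : Type*} [Field k] [Field K] [Algebra k K]

/-- The Riemann-Roch space `L(D)` of a divisor `D`. -/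
def rrSpace (D : FFDiv k K) : Submodule k K where
  carrier := {f | ∀ q : FFPoint k K, q.val f ≤ WithZero.exp (D q)}
  zero_mem' q := by simp
  add_mem' hf hg q := (q.val.map_add _ _).trans (max_le (hf q) (hg q))
  smul_mem' a f hf q := by
    rw [Algebra.smul_def, map_mul]
    have h1 := q.val_le_one_iff.mpr (q.algebraMap_mem a)
    exact (mul_le_of_le_one_left' h1).trans (hf q)

theorem rrSpace_mono {D E : FFDiv k K} (h : D ≤ E) : rrSpace D ≤ rrSpace E :=
  fun _ hf q => (hf q).trans (WithZero.exp_le_exp.mpr (h q))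

theorem FFDiv.degree_single (q : FFPoint k K) (n : ℤ) :
    FFDiv.degree k K (Finsupp.single q n) = n * q.degree := by
  simp [FFDiv.degree]

theorem FFDiv.degree_eq_sum (D : FFDiv k K) :
    FFDiv.degree k K D = ∑ q ∈ D.support, D q * q.degree := by
  simp [FFDiv.degree, Finsupp.sum]

theorem FFDiv.degree_nonneg {D : FFDiv k K} (hD : 0 ≤ D) : 0 ≤ FFDiv.degree k K D := by
  rw [FFDiv.degree_eq_sum]
  exact Finset.sum_nonneg fun q _ => mul_nonneg (hD q) (Nat.cast_nonneg _)

/-- The leading coefficient at `q` of the functions in `L(D + q)`, with respect to a function `c`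
of order `D(q) + 1`. -/
noncomputable def leadingCoeffMap (D : FFDiv k K) (q : FFPoint k K) {c : K}
    (hc : q.val c = WithZero.exp (-(D q + 1))) :
    rrSpace (D + Finsupp.single q 1) →ₗ[k] IsLocalRing.ResidueField q.valRing where
  toFun f := IsLocalRing.residue q.valRing ⟨f * c, by
    rw [← FFPoint.val_le_one_iff, map_mul, hc, WithZero.exp_neg]
    have h := f.2 q
    rw [Finsupp.add_apply, Finsupp.single_eq_same] at h
    exact mul_inv_le_one_of_le₀ h zero_le⟩
  map_add' f g := by
    rw [← map_add]
    exact congrArg _ (Subtype.ext (add_mul _ _ _))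
  map_smul' a f := by
    rw [RingHom.id_apply, Algebra.smul_def]
    refine Eq.trans (congrArg _ (Subtype.ext ?_)) (map_mul (IsLocalRing.residue q.valRing)
      (algebraMap k q.valRing a) _)
    exact (congrArg (· * c) (Algebra.smul_def a (f : K))).trans (mul_assoc _ _ _)

theorem ker_leadingCoeffMap_le (D : FFDiv k K) (q : FFPoint k K) {c : K}
    (hc : q.val c = WithZero.exp (-(D q + 1))) :
    (LinearMap.ker (leadingCoeffMap D q hc)).map (rrSpace (D + Finsupp.single q 1)).subtype ≤
      rrSpace D := by
  rintro _ ⟨f, hf, rfl⟩ r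
  by_cases hr : r = q
  · subst hr
    have h1 := r.val_lt_one_iff.mpr ((IsLocalRing.residue_eq_zero_iff _).mp hf)
    rw [map_mul, hc, WithZero.exp_neg, ← div_eq_mul_inv,
      div_lt_one₀ (WithZero.exp_pos)] at h1
    by_cases hf0 : (f : K) = 0
    · rw [Submodule.subtype_apply, hf0, map_zero]
      exact zero_le
    · have h2 := r.val_eq_exp (Units.mk0 _ hf0)
      rw [Units.val_mk0] at h2
      simp only [Submodule.subtype_apply] at h1 ⊢
      rw [h2, WithZero.exp_lt_exp] at h1
      rw [h2, WithZero.exp_le_exp]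
      omega
  · have h := f.2 r
    rwa [Finsupp.add_apply, Finsupp.single_eq_of_ne hr, add_zero] at h

namespace IsGlobalFunctionField

/-- The leading coefficient at `q` embeds `L(D + q)/L(D)` into the residue field, whose dimension is
`deg q`. -/
theorem rrSpace_add_single (hK : IsGlobalFunctionField k K) (D : FFDiv k K) (q : FFPoint k K)
    [FiniteDimensional k (rrSpace D)] :
    FiniteDimensional k (rrSpace (D + Finsupp.single q 1)) ∧
      Module.finrank k (rrSpace (D + Finsupp.single q 1)) ≤
        Module.finrank k (rrSpace D) + q.degree := by
  obtain ⟨c, hc⟩ := q.val_surjective (WithZero.exp (-(D q + 1)))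
  have hfin := q.finiteDimensional_residueField hK
  have hle := ker_leadingCoeffMap_le D q hc
  have e := (Submodule.equivMapOfInjective _ (Submodule.injective_subtype _)
    (LinearMap.ker (leadingCoeffMap D q hc)))
  have h1 : FiniteDimensional k ((LinearMap.ker (leadingCoeffMap D q hc)).map
    (rrSpace (D + Finsupp.single q 1)).subtype) := Submodule.finiteDimensional_of_le hle
  have h2 : FiniteDimensional k (LinearMap.ker (leadingCoeffMap D q hc)) := e.symm.finiteDimensional
  have h3 : FiniteDimensional k (rrSpace (D + Finsupp.single q 1)) := by
    refine ⟨Submodule.fg_of_fg_map_of_fg_inf_ker (leadingCoeffMap D q hc)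
      (IsNoetherian.noetherian _) ?_⟩
    rw [top_inf_eq]
    exact Module.Finite.iff_fg.mp h2
  refine ⟨h3, ?_⟩
  rw [← LinearMap.finrank_range_add_finrank_ker (leadingCoeffMap D q hc), add_comm]
  refine add_le_add ?_ (Submodule.finrank_le _)
  rw [e.finrank_eq]
  exact Submodule.finrank_mono hle

/-- Coefficients in `ℕ` allow an induction that adds one point at a time. -/
theorem rrSpace_add_natCast (hK : IsGlobalFunctionField k K) (E : FFPoint k K →₀ ℕ) :
    ∀ D : FFDiv k K, FiniteDimensional k (rrSpace D) →
    FiniteDimensional k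
        (rrSpace (D + Finsupp.mapRange.addMonoidHom (Nat.castAddMonoidHom ℤ) E)) ∧
      (Module.finrank k
          (rrSpace (D + Finsupp.mapRange.addMonoidHom (Nat.castAddMonoidHom ℤ) E)) : ℤ) ≤
        Module.finrank k (rrSpace D) +
          FFDiv.degree k K (Finsupp.mapRange.addMonoidHom (Nat.castAddMonoidHom ℤ) E) := by
  have hadd {E F : FFDiv k K}
      (hE : ∀ D : FFDiv k K, FiniteDimensional k (rrSpace D) →
        FiniteDimensional k (rrSpace (D + E)) ∧ (Module.finrank k (rrSpace (D + E)) : ℤ) ≤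
          Module.finrank k (rrSpace D) + FFDiv.degree k K E)
      (hF : ∀ D : FFDiv k K, FiniteDimensional k (rrSpace D) →
        FiniteDimensional k (rrSpace (D + F)) ∧ (Module.finrank k (rrSpace (D + F)) : ℤ) ≤
          Module.finrank k (rrSpace D) + FFDiv.degree k K F) (D : FFDiv k K)
      (hD : FiniteDimensional k (rrSpace D)) :
      FiniteDimensional k (rrSpace (D + (E + F))) ∧
        (Module.finrank k (rrSpace (D + (E + F))) : ℤ) ≤
          Module.finrank k (rrSpace D) + FFDiv.degree k K (E + F) := by
    obtain ⟨h1, h2⟩ := hE D hD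
    obtain ⟨h3, h4⟩ := hF (D + E) h1
    rw [← add_assoc, map_add]
    exact ⟨h3, by linarith⟩
  induction E using Finsupp.induction_linear with
  | zero => intro D hD; rw [map_zero, add_zero, map_zero, add_zero]; exact ⟨hD, le_rfl⟩
  | add E F hE hF => rw [map_add]; exact hadd hE hF
  | single q n =>
    induction n with
    | zero =>
      intro D hD
      rw [Finsupp.single_zero, map_zero, add_zero, map_zero, add_zero]
      exact ⟨hD, le_rfl⟩
    | succ n ih =>
      rw [Finsupp.single_add, map_add]
      refine hadd ih fun D hD => ?_
      have h1 : Finsupp.mapRange.addMonoidHom (Nat.castAddMonoidHom ℤ) (Finsupp.single q 1) =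
          Finsupp.single q 1 := by simp
      rw [h1, FFDiv.degree_single, one_mul]
      obtain ⟨h2, h3⟩ := hK.rrSpace_add_single D q
      exact ⟨h2, by exact_mod_cast h3⟩

theorem rrSpace_add_of_nonneg (hK : IsGlobalFunctionField k K) (D : FFDiv k K) {E : FFDiv k K}
    (hE : 0 ≤ E) [hD : FiniteDimensional k (rrSpace D)] :
    FiniteDimensional k (rrSpace (D + E)) ∧
      (Module.finrank k (rrSpace (D + E)) : ℤ) ≤
        Module.finrank k (rrSpace D) + FFDiv.degree k K E := by
  have h : E = Finsupp.mapRange.addMonoidHom (Nat.castAddMonoidHom ℤ)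
      (E.mapRange Int.toNat rfl) := by
    ext q
    simpa using (Int.toNat_of_nonneg (hE q)).symm
  rw [h]
  exact hK.rrSpace_add_natCast _ D hD

/-- A nonconstant function has a pole, namely a zero of its inverse. -/
theorem rrSpace_zero_le (hK : IsGlobalFunctionField k K) : rrSpace (0 : FFDiv k K) ≤ 1 := by
  intro f hf
  by_cases hf0 : f = 0
  · exact hf0 ▸ zero_mem _
  by_cases ht : Transcendental k f
  · have ht' : Transcendental k (((Units.mk0 f hf0)⁻¹ : Kˣ) : K) := by
      rw [Units.val_inv_eq_inv_val, Units.val_mk0]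
      exact fun h => ht (IsAlgebraic.inv_iff.mp h)
    obtain ⟨q, hq⟩ := FFPoint.exists_ord_pos hK ht'
    have h1 : 0 ≤ q.ord (Units.mk0 f hf0) := q.ord_nonneg_iff.mpr (by simpa using hf q)
    rw [FFPoint.ord_inv] at hq
    omega
  · exact Submodule.mem_one.mpr (hK.constants_full f (not_not.mp ht))

theorem finiteDimensional_rrSpace (hK : IsGlobalFunctionField k K) (D : FFDiv k K) :
    FiniteDimensional k (rrSpace D) := by
  have h1 : FiniteDimensional k (1 : Submodule k K) := by
    rw [Submodule.one_eq_span]; infer_instance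
  have h0 : FiniteDimensional k (rrSpace (0 : FFDiv k K)) :=
    Submodule.finiteDimensional_of_le hK.rrSpace_zero_le
  have h := (hK.rrSpace_add_of_nonneg 0 (le_sup_right : (0 : FFDiv k K) ≤ D ⊔ 0)).1
  rw [zero_add] at h
  exact Submodule.finiteDimensional_of_le (rrSpace_mono (le_sup_left : D ≤ D ⊔ 0))

theorem finrank_rrSpace_le (hK : IsGlobalFunctionField k K) {D : FFDiv k K} (hD : 0 ≤ D) :
    (Module.finrank k (rrSpace D) : ℤ) ≤ 1 + FFDiv.degree k K D := by
  have := hK.finiteDimensional_rrSpace (0 : FFDiv k K)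
  have h := (hK.rrSpace_add_of_nonneg 0 hD).2
  have h1 : FiniteDimensional k (1 : Submodule k K) := by
    rw [Submodule.one_eq_span]; infer_instance
  have h2 : Module.finrank k (rrSpace (0 : FFDiv k K)) ≤ 1 :=
    (Submodule.finrank_mono hK.rrSpace_zero_le).trans
      (by rw [Submodule.one_eq_span]; exact (finrank_span_singleton one_ne_zero).le)
  rw [zero_add] at h
  have h3 : (Module.finrank k (rrSpace (0 : FFDiv k K)) : ℤ) ≤ 1 := by exact_mod_cast h2
  linarith

end IsGlobalFunctionField

end RiemannRochSpace

/-! ### Principal divisors have degree zero; a weak Riemann theorem. -/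

section ProductFormula

variable {k K : Type*} [Field k] [Field K] [Algebra k K]

theorem Transcendental.inv {x : K} (hx : Transcendental k x) : Transcendental k x⁻¹ :=
  fun h => hx (IsAlgebraic.inv_iff.mp h)

theorem IntermediateField.adjoin_singleton_inv (x : K) :
    IntermediateField.adjoin k {x⁻¹} = IntermediateField.adjoin k {x} := by
  have h (y : K) : IntermediateField.adjoin k {y⁻¹} ≤ IntermediateField.adjoin k {y} := by
    rw [IntermediateField.adjoin_simple_le_iff]
    exact inv_mem (IntermediateField.mem_adjoin_simple_self k y)
  exact le_antisymm (h x) (by simpa using h x⁻¹)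

theorem Transcendental.linearIndependent_pow {A : Type*} [CommRing A] [Algebra k A] {x : A}
    (hx : Transcendental k x) : LinearIndependent k fun n : ℕ => x ^ n := by
  have h := (Polynomial.basisMonomials k).linearIndependent.map' (Polynomial.aeval x).toLinearMap
    (LinearMap.ker_eq_bot.mpr (transcendental_iff_injective.mp hx))
  simpa only [Function.comp_def, Polynomial.coe_basisMonomials, AlgHom.toLinearMap_apply,
    Polynomial.aeval_monomial, map_one, one_mul] using h

namespace IsGlobalFunctionField

/-- The divisor of a function. -/
noncomputable def div (hK : IsGlobalFunctionField k K) (x : Kˣ) : FFDiv k K :=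
  Finsupp.ofSupportFinite (fun q => q.ord x) (FFPoint.finite_setOf_ord_ne_zero hK x)

variable (hK : IsGlobalFunctionField k K)

theorem div_apply (x : Kˣ) (q : FFPoint k K) : hK.div x q = q.ord x := rfl

theorem div_inv (x : Kˣ) : hK.div x⁻¹ = -hK.div x := by
  ext q
  exact q.ord_inv x

theorem degree_div_sup_zero_le {x : Kˣ} (hx : Transcendental k (x : K)) :
    FFDiv.degree k K (hK.div x ⊔ 0) ≤
      Module.finrank (IntermediateField.adjoin k {(x : K)}) K := by
  have key : ∀ q ∈ (hK.div x ⊔ 0).support, 0 < q.ord x := by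
    intro q hq
    rw [Finsupp.mem_support_iff, Finsupp.sup_apply, div_apply, Finsupp.zero_apply] at hq
    by_contra h
    exact hq (sup_eq_right.mpr (not_lt.mp h))
  refine le_trans (le_of_eq ?_) (FFPoint.sum_ord_mul_degree_le hK hx _ key)
  rw [FFDiv.degree_eq_sum]
  refine Finset.sum_congr rfl fun q hq => ?_
  rw [Finsupp.sup_apply, div_apply, Finsupp.zero_apply, sup_eq_left.mpr (key q hq).le]

theorem val_le_exp_poles (x : Kˣ) (q : FFPoint k K) :
    q.val (x : K) ≤ WithZero.exp ((hK.div x⁻¹ ⊔ 0) q) := by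
  rw [q.val_eq_exp, WithZero.exp_le_exp, Finsupp.sup_apply, div_apply, FFPoint.ord_inv]
  exact le_sup_left

/-- There is a divisor `C` with `dim L(m (x)_∞ + C) ≥ (m + 1) [K : k(x)]` for all `m`. -/
theorem exists_mul_finrank_le_finrank_rrSpace {x : Kˣ} (hx : Transcendental k (x : K)) :
    ∃ C : FFDiv k K, 0 ≤ C ∧ ∀ m : ℕ,
      (m + 1) * Module.finrank (IntermediateField.adjoin k {(x : K)}) K ≤
        Module.finrank k (rrSpace (m • (hK.div x⁻¹ ⊔ 0) + C)) := by
  have := hK.finiteDimensional_adjoin hx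
  let u := Module.finBasis (IntermediateField.adjoin k {(x : K)}) K
  -- `C` bounds the poles of a basis `u` of `K / k(x)`. The products `x ^ i * u j` with `i ≤ m` are
  -- independent over `k` and lie in `L(m(x)_∞ + C)`.
  let C : FFDiv k K := ∑ j, (hK.div (Units.mk0 (u j) (u.ne_zero j))⁻¹ ⊔ 0)
  refine ⟨C, Finset.sum_nonneg fun j _ => le_sup_right, fun m => ?_⟩
  have := hK.finiteDimensional_rrSpace (m • (hK.div x⁻¹ ⊔ 0) + C)
  have hgen : Transcendental k (IntermediateField.AdjoinSimple.gen k (x : K)) := by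
    intro h
    exact hx (by simpa using h.algebraMap (A := K))
  have hli := linearIndependent_smul
    (hgen.linearIndependent_pow.comp ((↑) : Fin (m + 1) → ℕ) Fin.val_injective)
    u.linearIndependent
  have hmem (p : Fin (m + 1) × Fin _) :
      (IntermediateField.AdjoinSimple.gen k (x : K) ^ (p.1 : ℕ)) • u p.2 ∈
        rrSpace (m • (hK.div x⁻¹ ⊔ 0) + C) := by
    intro q
    rw [Algebra.smul_def, map_mul, map_pow, map_pow, IntermediateField.AdjoinSimple.algebraMap_gen,
      Finsupp.add_apply, WithZero.exp_add, Finsupp.smul_apply, nsmul_eq_mul]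
    refine mul_le_mul' ?_ ?_
    · refine (pow_le_pow_left' (hK.val_le_exp_poles x q) _).trans ?_
      rw [← WithZero.exp_nsmul, WithZero.exp_le_exp, nsmul_eq_mul]
      refine mul_le_mul_of_nonneg_right ?_ ?_
      · exact_mod_cast Nat.lt_succ_iff.mp p.1.2
      · exact (le_sup_right : (0 : FFDiv k K) ≤ hK.div x⁻¹ ⊔ 0) q
    · refine (hK.val_le_exp_poles (Units.mk0 (u p.2) (u.ne_zero p.2)) q).trans ?_
      rw [WithZero.exp_le_exp]
      exact (Finset.single_le_sum (f := fun j => hK.div (Units.mk0 (u j) (u.ne_zero j))⁻¹ ⊔ 0)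
        (fun j _ => le_sup_right) (Finset.mem_univ p.2)) q
  have hli' : LinearIndependent k (fun p => (⟨_, hmem p⟩ : rrSpace (m • (hK.div x⁻¹ ⊔ 0) + C))) :=
    LinearIndependent.of_comp (Submodule.subtype _) hli
  simpa using hli'.fintype_card_le_finrank

theorem degree_poles {x : Kˣ} (hx : Transcendental k (x : K)) :
    FFDiv.degree k K (hK.div x⁻¹ ⊔ 0) =
      Module.finrank (IntermediateField.adjoin k {(x : K)}) K := by
  refine le_antisymm ?_ ?_
  · have h := hK.degree_div_sup_zero_le (x := x⁻¹) (by simpa using hx.inv)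
    rwa [Units.val_inv_eq_inv_val, IntermediateField.adjoin_singleton_inv] at h
  · obtain ⟨C, hC, h⟩ := hK.exists_mul_finrank_le_finrank_rrSpace hx
    by_contra hlt
    rw [not_le] at hlt
    set d := FFDiv.degree k K (hK.div x⁻¹ ⊔ 0) with hd
    set n := Module.finrank (IntermediateField.adjoin k {(x : K)}) K with hn
    set c := FFDiv.degree k K C with hc
    have hc0 : 0 ≤ c := FFDiv.degree_nonneg hC
    have hd0 : 0 ≤ d := FFDiv.degree_nonneg le_sup_right
    -- For `m = c + 1` the two bounds give `(m + 1) n ≤ 1 + m d + c`; with `d ≤ n - 1` this forces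
    -- `n ≤ 0`, against `0 ≤ d < n`.
    have h1 := Int.ofNat_le.mpr (h (c.toNat + 1))
    have h2 := hK.finrank_rrSpace_le (D := (c.toNat + 1) • (hK.div x⁻¹ ⊔ 0) + C)
      (add_nonneg (nsmul_nonneg le_sup_right _) hC)
    rw [map_add, map_nsmul, ← hd, ← hc, nsmul_eq_mul] at h2
    push_cast at h1 h2
    rw [Int.toNat_of_nonneg hc0] at h1 h2
    nlinarith

/-- Zeros of `x` are poles of `x⁻¹`, and `k(x) = k(x⁻¹)`, so zeros and poles have the same degree.
-/
theorem degree_div (x : Kˣ) : FFDiv.degree k K (hK.div x) = 0 := by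
  by_cases hx : Transcendental k (x : K)
  · have h1 := hK.degree_poles hx
    have h2 := hK.degree_poles (x := x⁻¹) (by simpa using hx.inv)
    rw [inv_inv, Units.val_inv_eq_inv_val, IntermediateField.adjoin_singleton_inv] at h2
    have h3 : hK.div x = (hK.div x ⊔ 0) - (hK.div x⁻¹ ⊔ 0) := by
      ext q
      simp only [Finsupp.sub_apply, Finsupp.sup_apply, div_inv, Finsupp.neg_apply,
        Finsupp.zero_apply]
      omega
    rw [h3, map_sub, h1, h2, sub_self]
  · have h : hK.div x = 0 := by
      ext q
      by_contra h
      refine hx (q.transcendental_of_val_ne_one hK x.ne_zero fun h1 => h ?_)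
      rw [div_apply, FFPoint.ord_eq, h1, WithZero.log_one, neg_zero]; rfl
    rw [h, map_zero]

theorem degree_eq_zero_of_mem_principal (hK : IsGlobalFunctionField k K) {D : FFDiv k K}
    (hD : D ∈ FFDiv.principal k K) :
    FFDiv.degree k K D = 0 := by
  obtain ⟨f, hf⟩ := hD
  rw [show D = hK.div f from Finsupp.ext hf, degree_div]

/-- A weak form of Riemann's theorem, for multiples of one point. -/
theorem exists_ne_zero_mem_rrSpace (hK : IsGlobalFunctionField k K) (p : FFPoint k K)
    {E : FFDiv k K} (hE : 0 ≤ E) :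
    ∃ N : ℕ, ∃ f ∈ rrSpace (Finsupp.single p (N : ℤ) - E), f ≠ 0 := by
  obtain ⟨π, hπ0, hπ⟩ := p.exists_uniformizer
  have hπt := p.transcendental_of_val_ne_one hK hπ0 (hπ ▸ (FFPoint.exp_neg_lt_one one_pos).ne)
  -- The inverse of a uniformizer has a pole at `p`, so its polar divisor `P` satisfies `p ≤ P`.
  let x : Kˣ := (Units.mk0 π hπ0)⁻¹
  have hx : Transcendental k (x : K) := by simpa [x] using hπt.inv
  have := hK.finiteDimensional_adjoin hx
  obtain ⟨C, hC, h⟩ := hK.exists_mul_finrank_le_finrank_rrSpace hx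
  have hP := hK.degree_poles hx
  set P := hK.div x⁻¹ ⊔ 0 with hPdef
  have hP0 : 0 ≤ P := le_sup_right
  set n := Module.finrank (IntermediateField.adjoin k {(x : K)}) K
  have hn : 0 < n := Module.finrank_pos
  have hPp : 1 ≤ P p := by
    rw [hPdef, Finsupp.sup_apply, div_apply, inv_inv, FFPoint.ord_eq, Units.val_mk0, hπ,
      WithZero.log_exp, neg_neg]
    exact le_sup_left
  have hsingle (N : ℕ) : Finsupp.single p (N : ℤ) ≤ N • P := by
    intro q
    rw [Finsupp.smul_apply, nsmul_eq_mul]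
    by_cases hq : q = p
    · subst hq
      rw [Finsupp.single_eq_same]
      exact le_mul_of_one_le_right (Nat.cast_nonneg _) hPp
    · rw [Finsupp.single_eq_of_ne hq]
      exact mul_nonneg (Nat.cast_nonneg _) (hP0 q)
  -- `L(N P + C)` has dimension at least `(N + 1) n`, and passing down to `N p - E` costs at most
  -- `deg G = N n - N deg p + N`. At least `n + N (deg p - 1) > 0` remains.
  let N := (FFDiv.degree k K C + FFDiv.degree k K E).toNat
  have hN : (N : ℤ) = FFDiv.degree k K C + FFDiv.degree k K E :=
    Int.toNat_of_nonneg (add_nonneg (FFDiv.degree_nonneg hC) (FFDiv.degree_nonneg hE))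
  refine ⟨N, ?_⟩
  let G := (N • P + C) - (Finsupp.single p (N : ℤ) - E)
  have hG : 0 ≤ G := by
    have : G = (N • P - Finsupp.single p (N : ℤ)) + C + E := by simp only [G]; abel
    rw [this]
    exact add_nonneg (add_nonneg (sub_nonneg.mpr (hsingle N)) hC) hE
  have hGd : FFDiv.degree k K G = N * n - N * p.degree + N := by
    simp only [G, map_sub, map_add, map_nsmul, FFDiv.degree_single, hP, nsmul_eq_mul, hN]
    ring
  have := hK.finiteDimensional_rrSpace (Finsupp.single p (N : ℤ) - E)
  have h1 := (hK.rrSpace_add_of_nonneg (Finsupp.single p (N : ℤ) - E) hG).2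
  rw [add_sub_cancel, hGd] at h1
  have h2 := Int.ofNat_le.mpr (h N)
  have hdeg : (1 : ℤ) ≤ p.degree := by exact_mod_cast p.degree_pos hK
  push_cast at h2
  have h3 : (0 : ℤ) < Module.finrank k (rrSpace (Finsupp.single p (N : ℤ) - E)) := by
    have : (N : ℤ) ≤ N * p.degree := le_mul_of_one_le_right (Nat.cast_nonneg _) hdeg
    have : (0 : ℤ) < n := by exact_mod_cast hn
    nlinarith
  have : Nontrivial (rrSpace (Finsupp.single p (N : ℤ) - E)) :=
    Module.finrank_pos_iff.mp (by exact_mod_cast h3)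
  obtain ⟨f, hf⟩ := exists_ne (0 : rrSpace (Finsupp.single p (N : ℤ) - E))
  exact ⟨f, f.2, fun h => hf (Subtype.ext h)⟩

end IsGlobalFunctionField

end ProductFormula

/-! ### The class group as a quotient of the Picard group. -/

section ClassGroup

open IsDedekindDomain
open scoped nonZeroDivisors

section IdealDivisor

variable (B K : Type*) [CommRing B] [IsDedekindDomain B] [Field K] [Algebra B K]
  [IsFractionRing B K]

theorem FractionalIdeal.count_spanSingleton (P : HeightOneSpectrum B) (f : Kˣ) :
    FractionalIdeal.count K P (FractionalIdeal.spanSingleton B⁰ (f : K)) =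
      -WithZero.log (P.valuation K (f : K)) := by
  classical
  obtain ⟨a, b, hb, hab⟩ := IsFractionRing.div_surjective (A := B) (f : K)
  have hb0 : b ≠ 0 := nonZeroDivisors.ne_zero hb
  have ha0 : a ≠ 0 := by
    rintro rfl
    exact f.ne_zero (by rw [← hab, map_zero, zero_div])
  rw [FractionalIdeal.count_well_defined K P (a := b) (J := Ideal.span {a}), ← hab, map_div₀,
    HeightOneSpectrum.valuation_of_algebraMap, HeightOneSpectrum.valuation_of_algebraMap,
    WithZero.log_div (P.intValuation_ne_zero a ha0) (P.intValuation_ne_zero b hb0),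
    HeightOneSpectrum.intValuation_if_neg _ ha0, HeightOneSpectrum.intValuation_if_neg _ hb0,
    WithZero.log_exp, WithZero.log_exp]
  · ring
  · exact FractionalIdeal.spanSingleton_ne_zero_iff.mpr f.ne_zero
  · rw [FractionalIdeal.coeIdeal_span_singleton, FractionalIdeal.spanSingleton_mul_spanSingleton,
      ← hab, div_eq_inv_mul]

/-- The exponents in the prime factorization of an invertible fractional ideal. -/
noncomputable def idealExponents :
    Additive (FractionalIdeal B⁰ K)ˣ →+ (HeightOneSpectrum B →₀ ℤ) where
  toFun I := Finsupp.ofSupportFinite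
    (fun P => FractionalIdeal.count K P (I.toMul : FractionalIdeal B⁰ K))
    (FractionalIdeal.finite_factors _)
  map_zero' := by ext P; exact FractionalIdeal.count_one K P
  map_add' I J := by
    ext P
    exact FractionalIdeal.count_mul K P (Units.ne_zero _) (Units.ne_zero _)

theorem idealExponents_apply (I : Additive (FractionalIdeal B⁰ K)ˣ) (P : HeightOneSpectrum B) :
    idealExponents B K I P = FractionalIdeal.count K P (I.toMul : FractionalIdeal B⁰ K) := rfl

theorem idealExponents_injective : Function.Injective (idealExponents B K) := by
  intro I J h
  apply Additive.toMul.injective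
  apply Units.ext
  rw [← FractionalIdeal.finprod_heightOneSpectrum_factorization' K (Units.ne_zero I.toMul),
    ← FractionalIdeal.finprod_heightOneSpectrum_factorization' K (Units.ne_zero J.toMul)]
  exact finprod_congr fun P => congrArg _ (DFunLike.congr_fun h P)

theorem idealExponents_surjective : Function.Surjective (idealExponents B K) := by
  intro e
  have h0 : e.prod (fun P n => (P.asIdeal : FractionalIdeal B⁰ K) ^ n) ≠ 0 :=
    Finset.prod_ne_zero_iff.mpr fun P _ =>
      zpow_ne_zero _ (FractionalIdeal.coeIdeal_ne_zero.mpr P.ne_bot)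
  refine ⟨Additive.ofMul (Units.mk0 _ h0), Finsupp.ext fun P => ?_⟩
  exact FractionalIdeal.count_finsuppProd K P e

end IdealDivisor

variable {k K B : Type*} [Field k] [Field K] [Algebra k K] [CommRing B] [IsDedekindDomain B]
  [Algebra B K] [IsFractionRing B K] [Algebra k B] [IsScalarTower k B K]

theorem FFPoint.ofPrime_injective :
    Function.Injective (FFPoint.ofPrime : HeightOneSpectrum B → FFPoint k K) :=
  fun _ _ h => (FFPoint.equivHeightOneSpectrum k K B).symm.injective (Subtype.ext h)

theorem FFPoint.ord_ofPrime (P : HeightOneSpectrum B) (f : Kˣ) :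
    (FFPoint.ofPrime P : FFPoint k K).ord f = -WithZero.log (P.valuation K (f : K)) := by
  rw [FFPoint.ord_eq, FFPoint.val_ofPrime]

/-- The class of a divisor modulo the class of the point `p`. -/
noncomputable def FFPoint.toPicQuotient (p : FFPoint k K) :
    FFDiv k K →+ FFPic k K ⧸ AddSubgroup.zmultiples p.picClass :=
  (QuotientAddGroup.mk' _).comp (QuotientAddGroup.mk' (FFDiv.principal k K))

theorem FFPoint.toPicQuotient_surjective (p : FFPoint k K) :
    Function.Surjective p.toPicQuotient :=
  (QuotientAddGroup.mk'_surjective _).comp (QuotientAddGroup.mk'_surjective _)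

theorem FFPoint.toPicQuotient_eq_zero_iff (p : FFPoint k K) (D : FFDiv k K) :
    p.toPicQuotient D = 0 ↔ ∃ f : Kˣ, ∀ q ≠ p, D q = q.ord f := by
  rw [toPicQuotient, AddMonoidHom.comp_apply, QuotientAddGroup.mk'_apply,
    QuotientAddGroup.eq_zero_iff, AddSubgroup.mem_zmultiples_iff]
  have key (m : ℤ) : m • p.picClass = QuotientAddGroup.mk' (FFDiv.principal k K) D ↔
      D - m • Finsupp.single p 1 ∈ FFDiv.principal k K := by
    rw [FFPoint.picClass, ← map_zsmul, eq_comm, ← sub_eq_zero, ← map_sub,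
      QuotientAddGroup.mk'_apply, QuotientAddGroup.eq_zero_iff]
  simp_rw [key]
  constructor
  · rintro ⟨m, f, hf⟩
    refine ⟨f, fun q hq => ?_⟩
    simpa [Finsupp.single_eq_of_ne hq] using hf q
  · rintro ⟨f, hf⟩
    -- Modulo `[p]` the coefficient at `p` is free, so a multiple of `p` absorbs the discrepancy
    -- there.
    refine ⟨D p - p.ord f, f, fun q => ?_⟩
    by_cases hq : q = p
    · subst hq; simp
    · simpa [Finsupp.single_eq_of_ne hq] using hf q hq

variable (k K B) in
/-- The class, modulo the class of `p`, of the divisor of an invertible fractional ideal. -/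
noncomputable def idealToPic (p : FFPoint k K) : Additive (FractionalIdeal B⁰ K)ˣ →+
    FFPic k K ⧸ AddSubgroup.zmultiples p.picClass :=
  p.toPicQuotient.comp
    ((Finsupp.mapDomain.addMonoidHom FFPoint.ofPrime).comp (idealExponents B K))

variable {p : FFPoint k K}

theorem idealToPic_surjective
    (hp : ∀ q : FFPoint k K, q ∈ Set.range (FFPoint.ofPrime : HeightOneSpectrum B → _) ↔ q ≠ p) :
    Function.Surjective (idealToPic k K B p) := by
  intro y
  obtain ⟨D, rfl⟩ := p.toPicQuotient_surjective y
  obtain ⟨I, hI⟩ := idealExponents_surjective B K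
    (D.comapDomain FFPoint.ofPrime FFPoint.ofPrime_injective.injOn)
  refine ⟨I, sub_eq_zero.mp ((map_sub p.toPicQuotient _ D).symm.trans
    ((p.toPicQuotient_eq_zero_iff _).mpr ?_))⟩
  rw [AddMonoidHom.comp_apply, hI]
  -- The ideal carries the coefficients of `D` at all points but `p`; the difference is supported at
  -- `p` and needs only the constant function.
  refine ⟨1, fun q hq => ?_⟩
  obtain ⟨P, rfl⟩ := (hp q).mpr hq
  simp [Finsupp.mapDomain_apply FFPoint.ofPrime_injective, FFPoint.ord_one]

/-- Both sides ask for a function `f` whose order at each point other than `p` is the exponent of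
`I` there; exponents determine the ideal. -/
theorem idealToPic_eq_zero_iff
    (hp : ∀ q : FFPoint k K, q ∈ Set.range (FFPoint.ofPrime : HeightOneSpectrum B → _) ↔ q ≠ p)
    (I : (FractionalIdeal B⁰ K)ˣ) :
    idealToPic k K B p (Additive.ofMul I) = 0 ↔ I ∈ (toPrincipalIdeal B K).range := by
  refine (p.toPicQuotient_eq_zero_iff _).trans ?_
  rw [MonoidHom.mem_range]
  refine exists_congr fun f => ?_
  rw [← Additive.ofMul.injective.eq_iff, ← (idealExponents_injective B K).eq_iff, Finsupp.ext_iff]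
  have key (P : HeightOneSpectrum B) :
      idealExponents B K (Additive.ofMul (toPrincipalIdeal B K f)) P =
        (FFPoint.ofPrime P : FFPoint k K).ord f := by
    rw [idealExponents_apply, toMul_ofMul, coe_toPrincipalIdeal,
      FractionalIdeal.count_spanSingleton, FFPoint.ord_ofPrime]
  simp only [key]
  constructor
  · intro h P
    rw [← h _ ((hp _).mp ⟨P, rfl⟩)]
    simp [Finsupp.mapDomain_apply FFPoint.ofPrime_injective]
  · intro h q hq
    obtain ⟨P, rfl⟩ := (hp q).mpr hq
    rw [h]
    simp [Finsupp.mapDomain_apply FFPoint.ofPrime_injective]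

theorem nonempty_additive_quotient_addEquiv {G A : Type*} [CommGroup G] [AddCommGroup A]
    (N : Subgroup G) (ψ : Additive G →+ A) (hψ : Function.Surjective ψ)
    (hN : ∀ g, ψ (Additive.ofMul g) = 0 ↔ g ∈ N) : Nonempty (Additive (G ⧸ N) ≃+ A) := by
  let φ : G →* Multiplicative A := AddMonoidHom.toMultiplicativeRight ψ
  have hker : N = φ.ker := by
    ext g
    exact (hN g).symm
  subst hker
  exact ⟨(MulEquiv.toAdditive (QuotientGroup.quotientKerEquivOfSurjective φ hψ)).trans
    (AddEquiv.additiveMultiplicative A)⟩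

theorem nonempty_classGroup_equiv
    (hp : ∀ q : FFPoint k K, q ∈ Set.range (FFPoint.ofPrime : HeightOneSpectrum B → _) ↔ q ≠ p) :
    Nonempty (Additive (ClassGroup B) ≃+ FFPic k K ⧸ AddSubgroup.zmultiples p.picClass) := by
  have h := nonempty_additive_quotient_addEquiv (G := (FractionalIdeal B⁰ K)ˣ)
    (A := FFPic k K ⧸ AddSubgroup.zmultiples p.picClass)
    (toPrincipalIdeal B K).range (idealToPic k K B p)
  obtain ⟨e⟩ := h (idealToPic_surjective hp) (idealToPic_eq_zero_iff hp)
  exact ⟨(MulEquiv.toAdditive (ClassGroup.equiv K)).trans e⟩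

end ClassGroup

/-! ### The ring of functions regular away from `p`. -/

section RegularFunctions

open IsDedekindDomain

variable {k K : Type*} [Field k] [Field K] [Algebra k K]

theorem mem_regularFunctions {Y : Set (FFPoint k K)} {f : K} :
    f ∈ regularFunctions Y ↔ ∀ q ∈ Y, f ∈ q.valRing := by
  simp [regularFunctions, Subring.mem_iInf]

/-- The ring of regular functions is an algebra over the constants. -/
noncomputable instance regularFunctions.algebra (Y : Set (FFPoint k K)) :
    Algebra k (regularFunctions Y) :=
  ((algebraMap k K).codRestrict (regularFunctions Y) fun a =>
    mem_regularFunctions.mpr fun q _ => q.algebraMap_mem a).toAlgebra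

instance regularFunctions.isScalarTower (Y : Set (FFPoint k K)) :
    IsScalarTower k (regularFunctions Y) K :=
  IsScalarTower.of_algebraMap_eq fun _ => rfl

namespace IsGlobalFunctionField

/-- The weak Riemann theorem gives `f ≠ 0` with poles only at `p` that cancels the other poles of
`z`; then `z = (f z) / f`. -/
theorem isFractionRing_regularFunctions (hK : IsGlobalFunctionField k K)
    (p : FFPoint k K) :
    IsFractionRing (regularFunctions ({p}ᶜ : Set (FFPoint k K))) K := by
  refine IsFractionRing.of_field _ _ fun z => ?_
  by_cases hz : z = 0
  · exact ⟨0, 1, by simp [hz]⟩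
  obtain ⟨N, f, hf, hf0⟩ := hK.exists_ne_zero_mem_rrSpace p
    (le_sup_right : 0 ≤ hK.div (Units.mk0 z hz)⁻¹ ⊔ 0)
  have h1 (q : FFPoint k K) (hq : q ∈ ({p}ᶜ : Set (FFPoint k K))) :
      q.val f ≤ WithZero.exp (-((hK.div (Units.mk0 z hz)⁻¹ ⊔ 0) q)) := by
    have h := hf q
    rwa [Finsupp.sub_apply, Finsupp.single_eq_of_ne hq, zero_sub] at h
  have h2 : f ∈ regularFunctions ({p}ᶜ : Set (FFPoint k K)) :=
    mem_regularFunctions.mpr fun q hq => q.val_le_one_iff.mp <| (h1 q hq).trans <| by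
      rw [← WithZero.exp_zero, WithZero.exp_le_exp, neg_nonpos]
      exact (le_sup_right : 0 ≤ hK.div (Units.mk0 z hz)⁻¹ ⊔ 0) q
  have h3 : f * z ∈ regularFunctions ({p}ᶜ : Set (FFPoint k K)) :=
    mem_regularFunctions.mpr fun q hq => q.val_le_one_iff.mp <| by
      rw [map_mul]
      refine (mul_le_mul' (h1 q hq) (hK.val_le_exp_poles (Units.mk0 z hz) q)).trans ?_
      rw [← WithZero.exp_add, neg_add_cancel, WithZero.exp_zero]
  exact ⟨⟨f * z, h3⟩, ⟨f, h2⟩, (mul_div_cancel_left₀ z hf0).symm⟩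

theorem isDedekindDomain_regularFunctions (hK : IsGlobalFunctionField k K)
    (p : FFPoint k K) :
    IsDedekindDomain (regularFunctions ({p}ᶜ : Set (FFPoint k K))) := by
  have := hK.isFractionRing_regularFunctions p
  have : IsIntegrallyClosed (regularFunctions ({p}ᶜ : Set (FFPoint k K))) := by
    refine (isIntegrallyClosed_iff K).mpr fun {x} hx => ⟨⟨x, ?_⟩, rfl⟩
    exact mem_regularFunctions.mpr fun q hq =>
      q.mem_valRing_of_isIntegral (fun a => mem_regularFunctions.mp a.2 q hq) hx
  exact hK.isDedekindDomain (K := K) _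

theorem exists_transcendental (hK : IsGlobalFunctionField k K) : ∃ t : K, Transcendental k t := by
  obtain ⟨t, ht, -⟩ := hK.exists_finite_over_adjoin
  exact ⟨t, ht⟩

/-- Otherwise all these functions would lie in `L(0)`, hence be constants, and so would all of `K`,
their fraction field. This excludes `p` from the points given by maximal ideals. -/
theorem exists_mem_regularFunctions_notMem (hK : IsGlobalFunctionField k K)
    (p : FFPoint k K) :
    ∃ f ∈ regularFunctions ({p}ᶜ : Set (FFPoint k K)), f ∉ p.valRing := by
  by_contra! h
  have hR (f : regularFunctions ({p}ᶜ : Set (FFPoint k K))) :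
      ∃ a, algebraMap k K a = (f : K) := by
    have hf : (f : K) ∈ rrSpace (0 : FFDiv k K) := by
      intro q
      rw [Finsupp.zero_apply, WithZero.exp_zero, q.val_le_one_iff]
      by_cases hq : q = p
      · exact hq ▸ h f f.2
      · exact mem_regularFunctions.mp f.2 q hq
    exact Submodule.mem_one.mp (hK.rrSpace_zero_le hf)
  have := hK.isFractionRing_regularFunctions p
  obtain ⟨t, ht⟩ := hK.exists_transcendental
  obtain ⟨f, g, -, rfl⟩ :=
    IsFractionRing.div_surjective (A := regularFunctions ({p}ᶜ : Set (FFPoint k K))) t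
  obtain ⟨a, ha⟩ := hR f
  obtain ⟨b, hb⟩ := hR g
  refine ht ?_
  change IsAlgebraic k ((f : K) / (g : K))
  rw [← ha, ← hb, ← map_div₀]
  exact isAlgebraic_algebraMap _

theorem nonempty_classGroup_regularFunctions_equiv (hK : IsGlobalFunctionField k K)
    (p : FFPoint k K) :
    Nonempty (Additive (ClassGroup (regularFunctions ({p}ᶜ : Set (FFPoint k K)))) ≃+
      FFPic k K ⧸ AddSubgroup.zmultiples p.picClass) := by
  have := hK.isFractionRing_regularFunctions p
  have := hK.isDedekindDomain_regularFunctions p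
  refine nonempty_classGroup_equiv (K := K) fun q => ?_
  constructor
  · rintro ⟨P, rfl⟩ h
    obtain ⟨f, hf, hfp⟩ := hK.exists_mem_regularFunctions_notMem p
    exact hfp (h ▸ FFPoint.algebraMap_mem_ofPrime P ⟨f, hf⟩)
  · intro hq
    have hmem (b : regularFunctions ({p}ᶜ : Set (FFPoint k K))) : algebraMap _ K b ∈ q.valRing :=
      mem_regularFunctions.mp b.2 q hq
    exact ⟨q.centre _ hmem, FFPoint.ext (q.valuationSubringAtPrime_centre hmem)⟩

end IsGlobalFunctionField

end RegularFunctions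

/-! ### The `2`-rank of a quotient by a cyclic subgroup. -/

section TwoRank

universe u

variable {A B : Type u} [AddCommGroup A] [AddCommGroup B]

theorem ModN.mk_eq_zero_iff {a : A} :
    (Submodule.Quotient.mk a : ModN A 2) = 0 ↔ ∃ b, a = 2 • b := by
  rw [Submodule.Quotient.mk_eq_zero, LinearMap.mem_range]
  refine exists_congr fun b => ?_
  rw [LinearMap.lsmul_apply, eq_comm, natCast_zsmul]

/-- The homomorphism on `A / 2A` induced by a homomorphism. -/
noncomputable def ModN.mapTwo (f : A →+ B) : ModN A 2 →ₗ[ZMod 2] ModN B 2 :=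
  AddMonoidHom.toZModLinearMap 2 (Submodule.mapQ _ _ f.toIntLinearMap (by
    rintro _ ⟨a, rfl⟩
    exact ⟨f a, by simp⟩)).toAddMonoidHom

theorem ModN.mapTwo_surjective {f : A →+ B} (hf : Function.Surjective f) :
    Function.Surjective (ModN.mapTwo f) := by
  intro y
  obtain ⟨y, rfl⟩ := Submodule.Quotient.mk_surjective _ y
  obtain ⟨a, rfl⟩ := hf y
  exact ⟨Submodule.Quotient.mk a, rfl⟩

theorem twoRank_congr (e : A ≃+ B) : twoRank A = twoRank B :=
  le_antisymm
    (LinearMap.rank_le_of_surjective _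
      (ModN.mapTwo_surjective (f := e.symm.toAddMonoidHom) e.symm.surjective))
    (LinearMap.rank_le_of_surjective _
      (ModN.mapTwo_surjective (f := e.toAddMonoidHom) e.surjective))

/-- Rank-nullity for `A/2A → (A/⟨c⟩)/2`: an element `a` of the kernel differs from some `2b` by a
multiple of `c`. -/
theorem twoRank_eq_add_rank_span (c : A) :
    twoRank A = twoRank (A ⧸ AddSubgroup.zmultiples c) +
      Module.rank (ZMod 2) (Submodule.span (ZMod 2) {(Submodule.Quotient.mk c : ModN A 2)}) := by
  let f := ModN.mapTwo (QuotientAddGroup.mk' (AddSubgroup.zmultiples c))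
  have hsurj : Function.Surjective f :=
    ModN.mapTwo_surjective (QuotientAddGroup.mk'_surjective _)
  have hker : LinearMap.ker f = Submodule.span (ZMod 2) {(Submodule.Quotient.mk c : ModN A 2)} := by
    apply le_antisymm
    · intro x hx
      obtain ⟨a, rfl⟩ := Submodule.Quotient.mk_surjective _ x
      obtain ⟨b, hb⟩ := ModN.mk_eq_zero_iff.mp (LinearMap.mem_ker.mp hx)
      obtain ⟨b, rfl⟩ := QuotientAddGroup.mk'_surjective _ b
      rw [← map_nsmul] at hb
      obtain ⟨z, hz, hz'⟩ := (QuotientAddGroup.mk'_eq_mk' _).mp hb.symm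
      obtain ⟨m, rfl⟩ := AddSubgroup.mem_zmultiples_iff.mp hz
      rw [← hz', Submodule.Quotient.mk_add, ModN.mk_eq_zero_iff.mpr ⟨b, rfl⟩, zero_add,
        Submodule.Quotient.mk_smul]
      exact zsmul_mem (Submodule.mem_span_singleton_self _) m
    · rw [Submodule.span_singleton_le_iff_mem, LinearMap.mem_ker]
      refine ModN.mk_eq_zero_iff.mpr ⟨0, ?_⟩
      rw [smul_zero]
      exact (QuotientAddGroup.eq_zero_iff _).mpr (AddSubgroup.mem_zmultiples c)
  rw [← hker]
  exact (LinearMap.rank_eq_of_surjective hsurj)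

theorem twoRank_quotient_of_mem {c : A} (hc : ∃ b, c = 2 • b) :
    twoRank (A ⧸ AddSubgroup.zmultiples c) = twoRank A := by
  rw [twoRank_eq_add_rank_span c, ModN.mk_eq_zero_iff.mpr hc, Submodule.span_zero_singleton,
    rank_bot, add_zero]

theorem twoRank_quotient_of_notMem {c : A} (hc : ¬ ∃ b, c = 2 • b) :
    twoRank A = twoRank (A ⧸ AddSubgroup.zmultiples c) + 1 := by
  rw [twoRank_eq_add_rank_span c, Module.rank_eq_one_iff_finrank_eq_one.mpr
    (finrank_span_singleton (mt ModN.mk_eq_zero_iff.mp hc))]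

/-- Choose `a` with `d a = n` generating the image. Then `A = ker d ⊕ ℤa`, so `A/⟨a⟩ ≅ ker d`, and
`a ∉ 2A` because `n` is not twice a multiple of itself. No divisor of degree one is needed in the
application. -/
theorem twoRank_eq_twoRank_ker_add_one (d : A →+ ℤ) (hd : d ≠ 0) :
    twoRank A = twoRank d.ker + 1 := by
  obtain ⟨n, hn⟩ := Int.subgroup_cyclic d.range
  rw [← AddSubgroup.zmultiples_eq_closure] at hn
  have hn0 : n ≠ 0 := by
    rintro rfl
    refine hd ?_
    ext a
    have h : d a ∈ d.range := ⟨a, rfl⟩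
    rw [hn] at h
    simpa using h
  have hmem (a : A) : ∃ m : ℤ, m * n = d a := by
    have h : d a ∈ d.range := ⟨a, rfl⟩
    rw [hn] at h
    simpa [AddSubgroup.mem_zmultiples_iff] using h
  obtain ⟨a, ha⟩ : n ∈ d.range := hn ▸ AddSubgroup.mem_zmultiples n
  rw [twoRank_quotient_of_notMem (c := a)]
  · congr 1
    let φ : d.ker →+ A ⧸ AddSubgroup.zmultiples a :=
      (QuotientAddGroup.mk' (AddSubgroup.zmultiples a)).comp d.ker.subtype
    refine (twoRank_congr (AddEquiv.ofBijective φ ⟨?_, ?_⟩)).symm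
    · rw [injective_iff_map_eq_zero]
      rintro ⟨b, hb⟩ h
      obtain ⟨m, rfl⟩ := AddSubgroup.mem_zmultiples_iff.mp ((QuotientAddGroup.eq_zero_iff _).mp h)
      have h1 : m * n = 0 := by simpa [ha] using AddMonoidHom.mem_ker.mp hb
      have h2 : m = 0 := (mul_eq_zero.mp h1).resolve_right hn0
      simp [h2]
    · intro y
      obtain ⟨b, rfl⟩ := QuotientAddGroup.mk'_surjective _ y
      obtain ⟨m, hm⟩ := hmem b
      refine ⟨⟨b - m • a, by simp [AddMonoidHom.mem_ker, ha, hm]⟩, ?_⟩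
      refine (QuotientAddGroup.mk'_eq_mk' _).mpr ⟨m • a, ⟨m, rfl⟩, ?_⟩
      simp
  · rintro ⟨b, rfl⟩
    obtain ⟨m, hm⟩ := hmem b
    rw [map_nsmul, ← hm, nsmul_eq_mul, ← mul_assoc] at ha
    have h1 : ((2 : ℕ) : ℤ) * m = 1 := mul_right_cancel₀ hn0 (by rw [ha, one_mul])
    push_cast at h1
    omega

end TwoRank

/-! ### The degree on divisor classes, and the conclusion. -/

section Picard

variable {k K : Type*} [Field k] [Field K] [Algebra k K]

/-- The degree of a divisor class. -/
noncomputable def IsGlobalFunctionField.picDegree (hK : IsGlobalFunctionField k K) :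
    FFPic k K →+ ℤ :=
  QuotientAddGroup.lift _ (FFDiv.degree k K) fun _ hD => hK.degree_eq_zero_of_mem_principal hD

theorem IsGlobalFunctionField.ker_picDegree (hK : IsGlobalFunctionField k K) :
    hK.picDegree.ker = FFPicZero k K := by
  ext c
  obtain ⟨D, rfl⟩ := QuotientAddGroup.mk'_surjective _ c
  constructor
  · intro h
    exact ⟨D, h, rfl⟩
  · rintro ⟨E, hE, hED⟩
    rw [← hED]
    exact hE

theorem IsGlobalFunctionField.picDegree_picClass (hK : IsGlobalFunctionField k K)
    (p : FFPoint k K) : hK.picDegree p.picClass = p.degree :=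
  (FFDiv.degree_single p 1).trans (one_mul _)

theorem IsGlobalFunctionField.twoRank_pic (hK : IsGlobalFunctionField k K) (p : FFPoint k K) :
    twoRank (FFPic k K) = twoRank (FFPicZero k K) + 1 := by
  rw [← hK.ker_picDegree]
  refine twoRank_eq_twoRank_ker_add_one _ fun h => ?_
  have h1 := hK.picDegree_picClass p
  rw [h, AddMonoidHom.zero_apply] at h1
  exact (p.degree_pos hK).ne (by exact_mod_cast h1)

end Picard

theorem mainTheorem6 {k : Type*} {K : Type*} [Field k] [Field K] [Algebra k K]
    (hK : IsGlobalFunctionField k K) (hchar : ringChar K ≠ 2) (p : FFPoint k K) :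
    (¬ (∃ c : FFPic k K, p.picClass = 2 • c) →
      twoRank (Additive (ClassGroup (regularFunctions ({p}ᶜ : Set (FFPoint k K))))) =
        twoRank (FFPicZero k K)) ∧
    ((∃ c : FFPic k K, p.picClass = 2 • c) →
      twoRank (Additive (ClassGroup (regularFunctions ({p}ᶜ : Set (FFPoint k K))))) =
        1 + twoRank (FFPicZero k K)) := by
  obtain ⟨e⟩ := hK.nonempty_classGroup_regularFunctions_equiv p
  rw [twoRank_congr e]
  constructor
  · intro h
    -- Adding one is injective on all cardinals, so finiteness of the ranks plays no role.
    exact Cardinal.add_one_inj.mp ((twoRank_quotient_of_notMem h).symm.trans (hK.twoRank_pic p))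
  · intro h
    rw [twoRank_quotient_of_mem h, hK.twoRank_pic p, add_comm]
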